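/- Let $R$ be a commutative Noetherian ring. All algebras are associative and unital, $\otimes=\otimes_R$, and Sweedler's notation is used. Conventions. For a Hopf $R$-algebra $H$ let $H^*=\mathrm{Hom}_R(H,R)$, an $R$-algebra under the convolution product $(f\star g)(h)=\sum f(h_1)g(h_2)$ with unit $\varepsilon$, and an $H$-bimodule through $(af)(b)=f(ba)$, $(fa)(b)=f(ab)$. Put $H^\circ=\{f\in H^*\mid HfH \text{ is a finitely generated } R\text{-module}\}$. An $R$-submodule $K\subseteq M$ is called pure if $N\otimes K\to N\otimes M$ is injective for every $R$-module $N$; $H$ is a Hopf $\alpha$-algebra if $H^\circ\subseteq R^H$ is pure. In that case $H^\circ$ is an $R$-bialgebra, with $\Delta(f)=\sum f_1\otimes f_2$ determined by $f(hk)=\sum f_1(h)f_2(k)$ and with counit $f\mapsto f(1)$. An $R$-subbialgebra $U\subseteq H^\circ$ is a pure $R$-submodule that is a subalgebra (containing $\varepsilon$) with $\Delta(U)\subseteq U\otimes U$. A twisted antipode of $H$ is an $R$-linear map $\overline S:H\to H$ with $\sum\overline S(h_2)h_1=\varepsilon(h)1_H=\sum h_2\overline S(h_1)$ for all $h\in H$;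 put $\overline S^*(f)=f\circ\overline S$. Let $H$ be a Hopf $\alpha$-algebra over $R$ with a twisted antipode $\overline S$, let $U\subseteq H^\circ$ be an $R$-subbialgebra, and let $A$ be a left $H$-module algebra that is $U$-locally finite: for every $a\in A$ there are finitely many $f_1,\dots,f_k\in U$ such that every $h\in\bigcap_i\ker f_i$ satisfies $ha=0$. Then $A$ carries an induced right $U$-coaction $\varrho:A\to A\otimes U$, where $\varrho(a)=\sum a_{0}\otimes a_{1}$ is the unique element of $A\otimes U$ with $ha=\sum a_1(h)\,a_0$ for all $h\in H$. For each $a\in A$ choose an expression of $\varrho(a)$ as a finite sum $\sum a_0\otimes a_1$ with $a_0\in A$, $a_1\in U$, and let $\mathrm{Cf}(A)\subseteq U$ be the $R$-submodule generated by all the elements $a_1$ that occur in the chosen expressions. Assume that, for some such choice, there is a right $H$-submodule $V\subseteq H^*$ with $\mathrm{Cf}(A)\cup\overline S^*(\mathrm{Cf}(A))\subseteq V$ such that $(V,U)$ satisfies the RL-condition with respect to $H$: for every $g\in V$ there are finitely many pairs $(h_j,g_j)\in H\times U$ with $$\sum g(k_1)k_2=\sum_j\sum h_j\,k_1\,g_j(k_2)\qquad\text{for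 all }k\in H.$$ Then there is an isomorphism of $R$-algebras $$(A\#H)\#U\;\simeq\;A\otimes_R(H\#U).$$ Here $A\#H=A\otimes H$ has the multiplication $(a\#h)(b\#k)=\sum a(h_1b)\#h_2k$; it is a right $H$-comodule algebra through $\mathrm{id}\otimes\Delta$. For a right $H$-comodule algebra $B$ with coaction $b\mapsto\sum b_{0}\otimes b_{1}$, the algebra $B\#U=B\otimes U$ has the multiplication $(b\#f)(c\#g)=\sum bc_{0}\#(fc_{1})\star g$; this is applied to $B=A\#H$ and to $B=H$ with the coaction $\Delta$. -/

import Mathlib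

open scoped TensorProduct

namespace HopfDuality

universe u v w w'

noncomputable section

/-! ### Pure submodules -/

section Purity

variable {R : Type u} [CommRing R] {M : Type v} [AddCommGroup M] [Module R M]

/-- A submodule `K ⊆ M` is pure (in the sense of Cohn) if `N ⊗ K → N ⊗ M` is injective for every
`R`-module `N`.  The test modules `N` may be taken in the universe of `R`; then the
map is injective for the modules of every universe, see `IsPure.lTensor_injective`. -/
def IsPure (K : Submodule R M) : Prop :=
  ∀ (N : Type u) [AddCommGroup N] [Module R N], Function.Injective (K.subtype.lTensor N)

theorem IsPure.lTensor_injective {K : Submodule R M} (hK : IsPure K)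
    (N : Type w') [AddCommGroup N] [Module R N] : Function.Injective (K.subtype.lTensor N) := by
  rw [injective_iff_map_eq_zero]
  intro x hx
  obtain ⟨P, hP, t, rfl⟩ := Submodule.exists_fg_le_eq_rTensor_subtype x
  rw [← LinearMap.comp_apply, LinearMap.lTensor_comp_rTensor, ← LinearMap.rTensor_comp_lTensor,
    LinearMap.comp_apply] at hx
  obtain ⟨Q, hPQ, hQ, h⟩ := TensorProduct.eq_zero_of_fg_of_subtype_eq_zero hP hx
  rw [← LinearMap.comp_apply, LinearMap.rTensor_comp_lTensor, ← LinearMap.lTensor_comp_rTensor,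
    LinearMap.comp_apply] at h
  have : Small.{u} Q := Submodule.FG.small Q hQ
  have hinj : Function.Injective (K.subtype.lTensor Q) := by
    let e : Q ≃ₗ[R] Shrink.{u} Q := (Shrink.linearEquiv R Q).symm
    have h1 := hK (Shrink.{u} Q)
    have h2 : Function.Injective (K.subtype.lTensor (Shrink.{u} Q) ∘ₗ e.toLinearMap.rTensor K) :=
      h1.comp (LinearEquiv.rTensor K e).injective
    rw [LinearMap.lTensor_comp_rTensor, ← LinearMap.rTensor_comp_lTensor] at h2
    exact Function.Injective.of_comp h2
  have h0 : (Submodule.inclusion hPQ).rTensor K t = 0 := hinj (by rw [h, map_zero])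
  have : P.subtype = Q.subtype ∘ₗ Submodule.inclusion hPQ := rfl
  rw [this, LinearMap.rTensor_comp, LinearMap.comp_apply, h0, map_zero]

end Purity

/-! ### Twisted tensor products of algebras -/

section Twisted

variable (R : Type u) [CommRing R] (X : Type v) [Ring X] [Algebra R X]
  (Y : Type w) [Ring Y] [Algebra R Y]

variable {R X Y} in
/-- `x ⊗ y' ↦ (T x) (1 ⊗ y')` for a linear map `T : X → X ⊗ Y`. -/
def extendRight : (X →ₗ[R] X ⊗[R] Y) →ₗ[R] (X ⊗[R] Y →ₗ[R] X ⊗[R] Y) where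
  toFun T := TensorProduct.lift ((LinearMap.mul R (X ⊗[R] Y)).compl₁₂ T
    (Algebra.TensorProduct.includeRight : Y →ₐ[R] X ⊗[R] Y).toLinearMap)
  map_add' S T := by ext; simp
  map_smul' r T := by ext; simp

variable {R X Y} in
@[simp]
theorem extendRight_tmul (T : X →ₗ[R] X ⊗[R] Y) (x : X) (y : Y) :
    extendRight T (x ⊗ₜ y) = T x * (1 ⊗ₜ y) := by
  simp [extendRight]

variable {R X Y} in
/-- `x ⊗ y ↦ (x ⊗ 1) (T y)` for a linear map `T : Y → X ⊗ Y`. -/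
def extendLeft (T : Y →ₗ[R] X ⊗[R] Y) : X ⊗[R] Y →ₗ[R] X ⊗[R] Y :=
  TensorProduct.lift ((LinearMap.mul R (X ⊗[R] Y)).compl₁₂
    (Algebra.TensorProduct.includeLeft : X →ₐ[R] X ⊗[R] Y).toLinearMap T)

variable {R X Y} in
@[simp]
theorem extendLeft_tmul (T : Y →ₗ[R] X ⊗[R] Y) (x : X) (y : Y) :
    extendLeft T (x ⊗ₜ y) = (x ⊗ₜ 1) * T y := by
  simp [extendLeft]

/-- A twisting map `Y ⊗ X → X ⊗ Y`, the datum behind a multiplication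
`(x ⊗ y)(x' ⊗ y') = x T(y ⊗ x') y'` on `X ⊗ Y`. -/
structure TwistingMap where
  toMap : Y →ₗ[R] X →ₗ[R] X ⊗[R] Y
  map_one_left : ∀ x, toMap 1 x = x ⊗ₜ 1
  map_one_right : ∀ y, toMap y 1 = 1 ⊗ₜ y
  map_mul_left : ∀ y y' x, toMap (y * y') x = extendRight (toMap y) (toMap y' x)
  map_mul_right : ∀ y x x', toMap y (x * x') = extendLeft (toMap.flip x') (toMap y x)

variable {R X Y}

/-- The `R`-module `X ⊗ Y` with the multiplication given by a twisting map. -/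
def TwistedTensor (_T : TwistingMap R X Y) : Type max v w := X ⊗[R] Y

namespace TwistedTensor

variable (T : TwistingMap R X Y)

instance : AddCommGroup (TwistedTensor T) := inferInstanceAs (AddCommGroup (X ⊗[R] Y))

instance : Module R (TwistedTensor T) := inferInstanceAs (Module R (X ⊗[R] Y))

/-- The pure tensors of `X ⊗ Y`, as elements of the twisted tensor product. -/
def tmul (x : X) (y : Y) : TwistedTensor T := (x ⊗ₜ[R] y : X ⊗[R] Y)

/-- The identity map `X ⊗ Y → TwistedTensor T`. -/
def ofTensor : X ⊗[R] Y ≃ₗ[R] TwistedTensor T := LinearEquiv.refl R (X ⊗[R] Y)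

/-- The twisted multiplication: `(x ⊗ y)(x' ⊗ y') = (x ⊗ 1) T(y, x') (1 ⊗ y')`. -/
def mulMap : X ⊗[R] Y →ₗ[R] X ⊗[R] Y →ₗ[R] X ⊗[R] Y :=
  TensorProduct.lift (LinearMap.mk₂ R
    (fun x y => LinearMap.mulLeft R (x ⊗ₜ[R] (1 : Y)) ∘ₗ extendRight (T.toMap y))
    (fun x x' y => by ext; simp [TensorProduct.add_tmul, add_mul])
    (fun r x y => by ext; simp [← TensorProduct.smul_tmul'])
    (fun x y y' => by ext; simp [mul_add])
    (fun r x y => by ext; simp))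

theorem mulMap_tmul (x : X) (y : Y) (z : X ⊗[R] Y) :
    mulMap T (x ⊗ₜ y) z = (x ⊗ₜ 1) * extendRight (T.toMap y) z := by
  simp [mulMap]

theorem extendRight_mul (S : X →ₗ[R] X ⊗[R] Y) (z : X ⊗[R] Y) (y : Y) :
    extendRight S (z * (1 ⊗ₜ y)) = extendRight S z * (1 ⊗ₜ y) := by
  induction z with
  | zero => simp
  | add a b ha hb => simp [add_mul, ha, hb]
  | tmul a b => simp [mul_assoc]

theorem extendRight_comp (y y' : Y) (z : X ⊗[R] Y) :
    extendRight (T.toMap (y * y')) z = extendRight (T.toMap y) (extendRight (T.toMap y') z) := by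
  induction z with
  | zero => simp
  | add a b ha hb => simp [ha, hb]
  | tmul a b => simp [T.map_mul_left, extendRight_mul]

theorem mulMap_left (x : X) (w z : X ⊗[R] Y) :
    mulMap T ((x ⊗ₜ 1) * w) z = (x ⊗ₜ 1) * mulMap T w z := by
  induction w with
  | zero => simp
  | add a b ha hb => simp [mul_add, ha, hb]
  | tmul a b =>
    rw [Algebra.TensorProduct.tmul_mul_tmul, mulMap_tmul, mulMap_tmul, ← mul_assoc,
      Algebra.TensorProduct.tmul_mul_tmul]
    simp

theorem mulMap_right (y : Y) (w z : X ⊗[R] Y) :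
    mulMap T (w * (1 ⊗ₜ y)) z = mulMap T w (extendRight (T.toMap y) z) := by
  induction w with
  | zero => simp
  | add a b ha hb => simp [add_mul, ha, hb]
  | tmul a b =>
    rw [Algebra.TensorProduct.tmul_mul_tmul, mulMap_tmul, mulMap_tmul, extendRight_comp]
    simp

theorem extendRight_left (y : Y) (x : X) (z : X ⊗[R] Y) :
    extendRight (T.toMap y) ((x ⊗ₜ 1) * z) = mulMap T (T.toMap y x) z := by
  induction z with
  | zero => simp
  | add a b ha hb => simp [mul_add, ha, hb]
  | tmul a b =>
    rw [Algebra.TensorProduct.tmul_mul_tmul, one_mul, extendRight_tmul, T.map_mul_right]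
    generalize T.toMap y x = s
    induction s with
    | zero => simp
    | add s t hs ht => simp [add_mul, hs, ht]
    | tmul c d => simp [mulMap_tmul, mul_assoc]

theorem mulMap_assoc (a b c : X ⊗[R] Y) :
    mulMap T (mulMap T a b) c = mulMap T a (mulMap T b c) := by
  induction a with
  | zero => simp
  | add a a' ha ha' => simp [ha, ha']
  | tmul x y =>
    induction b with
    | zero => simp
    | add b b' hb hb' => simp [hb, hb']
    | tmul x' y' =>
      rw [mulMap_tmul, mulMap_tmul, mulMap_left, extendRight_tmul, mulMap_right, mulMap_tmul,
        extendRight_left]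

theorem one_mulMap (a : X ⊗[R] Y) : mulMap T (1 ⊗ₜ 1) a = a := by
  rw [mulMap_tmul]
  induction a with
  | zero => simp
  | add b c hb hc => rw [map_add, mul_add, hb, hc]
  | tmul x y => simp [T.map_one_left]

theorem mulMap_one (a : X ⊗[R] Y) : mulMap T a (1 ⊗ₜ 1) = a := by
  induction a with
  | zero => simp
  | add b c hb hc => rw [LinearMap.map_add₂, hb, hc]
  | tmul x y => simp [mulMap_tmul, T.map_one_right]

instance : Mul (TwistedTensor T) := ⟨fun a b => mulMap T a b⟩

instance : One (TwistedTensor T) := ⟨tmul T 1 1⟩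

instance : Ring (TwistedTensor T) :=
  { (inferInstance : AddCommGroup (TwistedTensor T)),
    (inferInstance : Mul (TwistedTensor T)),
    (inferInstance : One (TwistedTensor T)) with
    left_distrib := fun a b c => map_add (mulMap T a) b c
    right_distrib := fun a b c => LinearMap.map_add₂ (mulMap T) a b c
    zero_mul := fun a => LinearMap.map_zero₂ (mulMap T) a
    mul_zero := fun a => map_zero (mulMap T a)
    mul_assoc := mulMap_assoc T
    one_mul := one_mulMap T
    mul_one := mulMap_one T }

instance : Algebra R (TwistedTensor T) :=
  Algebra.ofModule (fun r a b => LinearMap.map_smul₂ (mulMap T) r a b)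
    (fun r a b => map_smul (mulMap T a) r b)

theorem ofTensor_tmul (x : X) (y : Y) : ofTensor T (x ⊗ₜ y) = tmul T x y := rfl

theorem one_def : (1 : TwistedTensor T) = tmul T 1 1 := rfl

theorem ofTensor_mul (a b : X ⊗[R] Y) :
    ofTensor T a * ofTensor T b = ofTensor T (mulMap T a b) := rfl

theorem tmul_mul_tmul (x x' : X) (y y' : Y) :
    tmul T x y * tmul T x' y' =
      ofTensor T ((x ⊗ₜ 1) * (T.toMap y x' * (1 ⊗ₜ y'))) := by
  rw [← ofTensor_tmul, ← ofTensor_tmul, ofTensor_mul, mulMap_tmul, extendRight_tmul]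

end TwistedTensor

end Twisted

/-! ### Module algebras and the left smash product `A # H` -/

section LeftSmash

variable (R : Type u) [CommRing R] (H : Type v) [Ring H] [Bialgebra R H]
  (A : Type w) [Ring A] [Algebra R A] [Module H A] [IsScalarTower R H A]

variable {A} in
/-- The orbit map `h ↦ h a`. -/
def orbitMap (a : A) : H →ₗ[R] A := (LinearMap.toSpanSingleton H A a).restrictScalars R

variable {A} in
@[simp]
theorem orbitMap_apply (a : A) (h : H) : orbitMap R H a h = h • a := rfl

/-- `A` is a left `H`-module algebra: `h 1 = ε(h) 1` and `h (a b) = ∑ (h₁ a) (h₂ b)`. -/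
class IsModuleAlgebra : Prop where
  smul_one : ∀ h : H, h • (1 : A) = algebraMap R A (Coalgebra.counit h)
  smul_mul : ∀ (h : H) (a b : A), h • (a * b) =
    LinearMap.mul' R A (TensorProduct.map (orbitMap R H a) (orbitMap R H b) (Coalgebra.comul h))

/-- `h ⊗ k ↦ (a ↦ h a ⊗ k)`. -/
def actFirst : H ⊗[R] H →ₗ[R] A →ₗ[R] A ⊗[R] H :=
  LinearMap.mk₂ R (fun s a => (orbitMap R H a).rTensor H s)
    (fun s t a => by simp) (fun r s a => by simp)
    (fun s a b => by
      have : orbitMap R H (a + b) = orbitMap R H a + orbitMap R H b := by ext; simp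
      simp [this, LinearMap.rTensor_add])
    (fun r s a => by
      have : orbitMap R H (r • a) = r • orbitMap R H a := by
        ext h
        rw [LinearMap.smul_apply, orbitMap_apply, orbitMap_apply, ← algebraMap_smul H r a,
          ← mul_smul, ← Algebra.commutes, mul_smul, algebraMap_smul]
      simp [this, LinearMap.rTensor_smul])

theorem actFirst_apply (s : H ⊗[R] H) (a : A) :
    actFirst R H A s a = (orbitMap R H a).rTensor H s := rfl

@[simp]
theorem actFirst_tmul (h k : H) (a : A) : actFirst R H A (h ⊗ₜ k) a = (h • a) ⊗ₜ k := rfl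

theorem actFirst_mul (s t : H ⊗[R] H) (a : A) :
    actFirst R H A (s * t) a = extendRight (actFirst R H A s) (actFirst R H A t a) := by
  induction s with
  | zero => simp
  | add s s' hs hs' => simp [add_mul, hs, hs']
  | tmul h k =>
    induction t with
    | zero => simp
    | add t t' ht ht' => simp [mul_add, ht, ht']
    | tmul h' k' => simp [mul_smul]

variable [IsModuleAlgebra R H A]

/-- The twisting map `h ⊗ a ↦ ∑ h₁ a ⊗ h₂`. -/
def leftTwist : TwistingMap R A H where
  toMap := actFirst R H A ∘ₗ Coalgebra.comul
  map_one_left a := by simp [Algebra.TensorProduct.one_def]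
  map_one_right h := by
    have : orbitMap R H (1 : A) = Algebra.linearMap R A ∘ₗ Coalgebra.counit := by
      ext h; simp [IsModuleAlgebra.smul_one (R := R)]
    simp [actFirst_apply, this, LinearMap.rTensor_comp]
  map_mul_left h h' a := by simp [actFirst_mul]
  map_mul_right h a b := by
    let G : H ⊗[R] H →ₗ[R] A :=
      LinearMap.mul' R A ∘ₗ TensorProduct.map (orbitMap R H a) (orbitMap R H b)
    have h1 : orbitMap R H (a * b) = G ∘ₗ Coalgebra.comul := by
      ext k; simp [G, IsModuleAlgebra.smul_mul (R := R)]
    have h2 : ∀ s : H ⊗[R] H,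
        extendLeft ((actFirst R H A ∘ₗ Coalgebra.comul).flip b) (actFirst R H A s a) =
          G.rTensor H ((TensorProduct.assoc R H H H).symm (Coalgebra.comul.lTensor H s)) := by
      intro s
      induction s with
      | zero => simp
      | add s t hs ht => simp [hs, ht]
      | tmul k l =>
        simp only [actFirst_tmul, extendLeft_tmul, LinearMap.flip_apply, LinearMap.comp_apply,
          LinearMap.lTensor_tmul]
        generalize (Coalgebra.comul l : H ⊗[R] H) = t
        induction t with
        | zero => simp
        | add s t hs ht => simp [mul_add, TensorProduct.tmul_add, hs, ht]
        | tmul c d => simp [G]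
    rw [LinearMap.comp_apply, h2, actFirst_apply, h1, LinearMap.rTensor_comp,
      LinearMap.comp_apply, Coalgebra.coassoc_symm_apply]

/-- The left smash product `A # H`, with `(a # h)(b # k) = ∑ a (h₁ b) # h₂ k`. -/
abbrev LeftSmash : Type max v w := TwistedTensor (leftTwist R H A)

theorem LeftSmash.tmul_mul_tmul (a b : A) (h k : H) {ι : Type*} (s : Finset ι) (h₁ h₂ : ι → H)
    (hs : Coalgebra.comul (R := R) h = ∑ i ∈ s, h₁ i ⊗ₜ h₂ i) :
    (TwistedTensor.tmul _ a h * TwistedTensor.tmul _ b k : LeftSmash R H A) =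
      ∑ i ∈ s, TwistedTensor.tmul _ (a * (h₁ i • b)) (h₂ i * k) := by
  have : (a ⊗ₜ[R] (1 : H)) * ((leftTwist R H A).toMap h b * (1 ⊗ₜ k)) =
      ∑ i ∈ s, (a * (h₁ i • b)) ⊗ₜ (h₂ i * k) := by
    simp [leftTwist, hs, Finset.sum_mul, Finset.mul_sum]
  rw [TwistedTensor.tmul_mul_tmul, this, map_sum]
  rfl

end LeftSmash

/-! ### Comodule algebras -/

section ComoduleAlgebra

/-- A right `H`-comodule algebra structure on `B`: an algebra map `B → B ⊗ H` that is coassociative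
and counital. -/
class RightComoduleAlgebra (R : Type u) [CommRing R] (H : Type v) [Ring H] [Bialgebra R H]
    (B : Type w) [Ring B] [Algebra R B] where
  coact : B →ₐ[R] B ⊗[R] H
  coassoc : ∀ b, TensorProduct.assoc R B H H (coact.toLinearMap.rTensor H (coact b)) =
    Coalgebra.comul.lTensor B (coact b)
  counit : ∀ b, TensorProduct.rid R B (Coalgebra.counit.lTensor B (coact b)) = b

variable (R : Type u) [CommRing R] (H : Type v) [Ring H] [Bialgebra R H]

/-- `H` is a right `H`-comodule algebra through its comultiplication. -/
instance : RightComoduleAlgebra R H H where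
  coact := Bialgebra.comulAlgHom R H
  coassoc := Coalgebra.coassoc_apply
  counit b := by simp

variable (A : Type w) [Ring A] [Algebra R A] [Module H A] [IsScalarTower R H A]
  [IsModuleAlgebra R H A]

/-- The map `a # h ↦ ∑ (a # h₁) ⊗ h₂`. -/
def LeftSmash.coactMap : LeftSmash R H A →ₗ[R] LeftSmash R H A ⊗[R] H :=
  (TwistedTensor.ofTensor (leftTwist R H A)).toLinearMap.rTensor H ∘ₗ
    (TensorProduct.assoc R A H H).symm.toLinearMap ∘ₗ Coalgebra.comul.lTensor A ∘ₗ
    (TwistedTensor.ofTensor (leftTwist R H A)).symm.toLinearMap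

theorem LeftSmash.coactMap_tmul (a : A) (h : H) :
    coactMap R H A (TwistedTensor.tmul _ a h) =
      (TwistedTensor.ofTensor (leftTwist R H A)).toLinearMap.rTensor H
        ((TensorProduct.assoc R A H H).symm (a ⊗ₜ Coalgebra.comul h)) := rfl

theorem LeftSmash.coactMap_mul (x y : LeftSmash R H A) :
    coactMap R H A (x * y) = coactMap R H A x * coactMap R H A y := by
  let E := (TwistedTensor.ofTensor (leftTwist R H A)).toLinearMap.rTensor H ∘ₗ
    (TensorProduct.assoc R A H H).symm.toLinearMap
  have hE : ∀ (a : A) (h : H),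
      coactMap R H A (TwistedTensor.ofTensor _ (a ⊗ₜ h)) = E (a ⊗ₜ Coalgebra.comul h) :=
    fun a h => rfl
  let Ψ (a b : A) (t : H ⊗[R] H) : H ⊗[R] (H ⊗[R] H) →ₗ[R] LeftSmash R H A ⊗[R] H :=
    E ∘ₗ TensorProduct.map (LinearMap.mulLeft R a ∘ₗ orbitMap R H b) (LinearMap.mulRight R t)
  have hL : ∀ (a b : A) (k : H) (s : H ⊗[R] H),
      coactMap R H A (TwistedTensor.ofTensor _
        ((a ⊗ₜ 1) * (actFirst R H A s b * (1 ⊗ₜ k)))) =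
      Ψ a b (Coalgebra.comul k) (Coalgebra.comul.lTensor H s) := by
    intro a b k s
    induction s with
    | zero => simp
    | add s t hs ht =>
      rw [map_add, LinearMap.add_apply, add_mul, mul_add, map_add, map_add, hs, ht, map_add,
        map_add]
    | tmul u v =>
      simp only [actFirst_tmul, Algebra.TensorProduct.tmul_mul_tmul, mul_one, one_mul, hE]
      simp [Ψ]
  have hM : ∀ (a b : A) (c d p q : H),
      E (a ⊗ₜ (c ⊗ₜ d)) * E (b ⊗ₜ (p ⊗ₜ q)) =
        Ψ a b (p ⊗ₜ q) (TensorProduct.assoc R H H H (Coalgebra.comul c ⊗ₜ d)) := by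
    intro a b c d p q
    have : E (a ⊗ₜ (c ⊗ₜ d)) * E (b ⊗ₜ (p ⊗ₜ q)) =
        (TwistedTensor.ofTensor _ (TwistedTensor.mulMap (leftTwist R H A) (a ⊗ₜ c) (b ⊗ₜ p))) ⊗ₜ (d * q) := by
      rw [← TwistedTensor.ofTensor_mul]
      exact Algebra.TensorProduct.tmul_mul_tmul _ _ _ _
    rw [this, TwistedTensor.mulMap_tmul, extendRight_tmul]
    change TwistedTensor.ofTensor _ ((a ⊗ₜ 1) *
      (actFirst R H A (Coalgebra.comul c) b * (1 ⊗ₜ p))) ⊗ₜ[R] (d * q) = _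
    generalize (Coalgebra.comul c : H ⊗[R] H) = s
    induction s with
    | zero => simp
    | add s t hs ht =>
      rw [map_add, LinearMap.add_apply, add_mul, mul_add, map_add, TensorProduct.add_tmul, hs, ht,
        TensorProduct.add_tmul, map_add, map_add]
    | tmul u v => simp [Ψ, E]
  have hR : ∀ (a b : A) (s t : H ⊗[R] H), E (a ⊗ₜ s) * E (b ⊗ₜ t) =
      Ψ a b t (TensorProduct.assoc R H H H (Coalgebra.comul.rTensor H s)) := by
    intro a b s t
    induction s with
    | zero => simp
    | add s s' hs hs' => simp only [TensorProduct.tmul_add, map_add, add_mul, hs, hs']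
    | tmul c d =>
      induction t with
      | zero => simp [Ψ]
      | add t t' ht ht' =>
        rw [TensorProduct.tmul_add, map_add, mul_add, ht, ht']
        have hadd : Ψ a b (t + t') = Ψ a b t + Ψ a b t' := by
          ext; simp [Ψ, mul_add, TensorProduct.tmul_add]
        rw [hadd, LinearMap.add_apply]
      | tmul p q => rw [hM, LinearMap.rTensor_tmul]
  obtain ⟨x, rfl⟩ := (TwistedTensor.ofTensor _).surjective x
  obtain ⟨y, rfl⟩ := (TwistedTensor.ofTensor _).surjective y
  induction x with
  | zero => simp
  | add x x' hx hx' => rw [map_add, add_mul, map_add, map_add, add_mul, hx, hx']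
  | tmul a h =>
    induction y with
    | zero => simp
    | add y y' hy hy' => rw [map_add, mul_add, map_add, map_add, mul_add, hy, hy']
    | tmul b k =>
      rw [hE, hE, hR, Coalgebra.coassoc_apply, ← hL, TwistedTensor.ofTensor_mul,
        TwistedTensor.mulMap_tmul, extendRight_tmul]
      rfl

/-- `A # H` is a right `H`-comodule algebra through `id ⊗ Δ`. -/
instance : RightComoduleAlgebra R H (LeftSmash R H A) where
  coact := AlgHom.ofLinearMap (LeftSmash.coactMap R H A)
    (by
      rw [TwistedTensor.one_def, LeftSmash.coactMap_tmul, Bialgebra.comul_one]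
      rfl)
    (LeftSmash.coactMap_mul R H A)
  coassoc x := by
    obtain ⟨x, rfl⟩ := (TwistedTensor.ofTensor _).surjective x
    induction x with
    | zero => simp
    | add x x' hx hx' => simp only [map_add, hx, hx']
    | tmul a h =>
      let F : H ⊗[R] (H ⊗[R] H) →ₗ[R] LeftSmash R H A ⊗[R] (H ⊗[R] H) :=
        ((TwistedTensor.ofTensor (leftTwist R H A)).toLinearMap ∘ₗ
          TensorProduct.mk R A H a).rTensor (H ⊗[R] H)
      let E := (TwistedTensor.ofTensor (leftTwist R H A)).toLinearMap.rTensor H ∘ₗ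
        (TensorProduct.assoc R A H H).symm.toLinearMap
      have h1 : ∀ s : H ⊗[R] H, TensorProduct.assoc R _ H H
          ((LeftSmash.coactMap R H A).rTensor H (E (a ⊗ₜ s))) =
          F (TensorProduct.assoc R H H H (Coalgebra.comul.rTensor H s)) := by
        intro s
        induction s with
        | zero => simp
        | add s t hs ht => simp only [TensorProduct.tmul_add, map_add, hs, ht]
        | tmul u v =>
          have : (LeftSmash.coactMap R H A).rTensor H (E (a ⊗ₜ (u ⊗ₜ v))) =
            E (a ⊗ₜ Coalgebra.comul u) ⊗ₜ v := rfl
          rw [this, LinearMap.rTensor_tmul]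
          generalize (Coalgebra.comul u : H ⊗[R] H) = t
          induction t with
          | zero => simp
          | add t t' ht ht' =>
            simp only [TensorProduct.tmul_add, TensorProduct.add_tmul, map_add, ht, ht']
          | tmul p q => rfl
      have h2 : ∀ s : H ⊗[R] H, Coalgebra.comul.lTensor (LeftSmash R H A) (E (a ⊗ₜ s)) =
          F (Coalgebra.comul.lTensor H s) := by
        intro s
        induction s with
        | zero => simp
        | add s t hs ht => simp only [TensorProduct.tmul_add, map_add, hs, ht]
        | tmul u v => rfl
      exact (h1 _).trans ((congrArg F (Coalgebra.coassoc_apply h)).trans (h2 _).symm)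
  counit x := by
    obtain ⟨x, rfl⟩ := (TwistedTensor.ofTensor _).surjective x
    induction x with
    | zero => simp
    | add x x' hx hx' => simp only [map_add, hx, hx']
    | tmul a h =>
      let E := (TwistedTensor.ofTensor (leftTwist R H A)).toLinearMap.rTensor H ∘ₗ
        (TensorProduct.assoc R A H H).symm.toLinearMap
      have h1 : ∀ s : H ⊗[R] H, TensorProduct.rid R _
          (Coalgebra.counit.lTensor (LeftSmash R H A) (E (a ⊗ₜ s))) =
          TwistedTensor.ofTensor _
            (a ⊗ₜ TensorProduct.rid R H (Coalgebra.counit.lTensor H s)) := by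
        intro s
        induction s with
        | zero => simp
        | add s t hs ht => simp only [TensorProduct.tmul_add, map_add, hs, ht]
        | tmul u v => simp [E]
      exact (h1 _).trans (by simp)

end ComoduleAlgebra

/-! ### The convolution algebra `H*` and the right smash product `B # U` -/

section RightSmash

variable (R : Type u) [CommRing R] (H : Type v) [Ring H] [Bialgebra R H]

/-- The dual `H* = Hom(H, R)` with the convolution product `(f ⋆ g)(h) = ∑ f(h₁) g(h₂)` and the
unit `ε`. -/
abbrev ConvDual : Type max u v := WithConv (H →ₗ[R] R)

/-- The right regular action of `H` on `H*`: `(f h)(k) = f (h k)`. -/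
def rightReg : ConvDual R H →ₗ[R] H →ₗ[R] ConvDual R H :=
  LinearMap.mk₂ R (fun f h => WithConv.toConv (f.ofConv ∘ₗ LinearMap.mulLeft R h))
    (fun f g h => by ext; simp) (fun r f h => by ext; simp)
    (fun f h k => by ext; simp [add_mul]) (fun r f h => by ext; simp)

/-- The left regular action of `H` on `H*`: `(h f)(k) = f (k h)`. -/
def leftReg : ConvDual R H →ₗ[R] H →ₗ[R] ConvDual R H :=
  LinearMap.mk₂ R (fun f h => WithConv.toConv (f.ofConv ∘ₗ LinearMap.mulRight R h))
    (fun f g h => by ext; simp) (fun r f h => by ext; simp)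
    (fun f h k => by ext; simp [mul_add]) (fun r f h => by ext; simp)

variable {R H}

@[simp]
theorem rightReg_apply (f : ConvDual R H) (h k : H) : rightReg R H f h k = f (h * k) := rfl

@[simp]
theorem leftReg_apply (f : ConvDual R H) (h k : H) : leftReg R H f h k = f (k * h) := rfl

theorem rightReg_mul (f : ConvDual R H) (h k : H) :
    rightReg R H f (h * k) = rightReg R H (rightReg R H f h) k := by
  ext l
  simp [mul_assoc]

theorem rightReg_convMul (f g : ConvDual R H) (h : H) :
    rightReg R H (f * g) h = LinearMap.mul' R (ConvDual R H)
      (TensorProduct.map (rightReg R H f) (rightReg R H g) (Coalgebra.comul h)) := by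
  have key : ∀ s : H ⊗[R] H, ∀ l : H,
      LinearMap.mul' R R (TensorProduct.map f.ofConv g.ofConv (s * Coalgebra.comul l)) =
        (LinearMap.mul' R (ConvDual R H)
          (TensorProduct.map (rightReg R H f) (rightReg R H g) s)) l := by
    intro s l
    induction s with
    | zero => simp
    | add s t hs ht => simp [add_mul, hs, ht]
    | tmul u v =>
      rw [TensorProduct.map_tmul, LinearMap.mul'_apply, LinearMap.convMul_apply]
      generalize (Coalgebra.comul l : H ⊗[R] H) = t
      induction t with
      | zero => simp
      | add t t' ht ht' => simp [mul_add, ht, ht']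
      | tmul p q => simp
  ext l
  rw [← key, ← Bialgebra.comul_mul]
  rfl

theorem rightReg_one (h : H) :
    rightReg R H (1 : ConvDual R H) h = (Coalgebra.counit h : R) • (1 : ConvDual R H) := by
  ext l
  simp

variable (R H)

/-- A right `H`-module subalgebra of `H*` (containing `ε`). -/
structure RightModuleSubalgebra extends Subalgebra R (ConvDual R H) where
  rightReg_mem : ∀ f ∈ carrier, ∀ h : H, rightReg R H f h ∈ carrier

variable {R H}
variable (U : RightModuleSubalgebra R H)

/-- The right action of `H` on `U`. -/
def RightModuleSubalgebra.act : U.toSubalgebra →ₗ[R] H →ₗ[R] U.toSubalgebra :=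
  LinearMap.mk₂ R (fun f h => ⟨rightReg R H f h, U.rightReg_mem f f.2 h⟩)
    (fun f g h => by ext; simp) (fun r f h => by ext; simp)
    (fun f h k => by ext; simp) (fun r f h => by ext; simp)

@[simp]
theorem RightModuleSubalgebra.coe_act (f : U.toSubalgebra) (h : H) :
    (U.act f h : ConvDual R H) = rightReg R H f h := rfl

variable (B : Type w) [Ring B] [Algebra R B] [RightComoduleAlgebra R H B]

/-- The map `f ⊗ b ↦ ∑ b₀ ⊗ f b₁`. -/
def rightTwistMap : U.toSubalgebra →ₗ[R] B →ₗ[R] B ⊗[R] U.toSubalgebra :=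
  LinearMap.mk₂ R
    (fun f b => (U.act f).lTensor B (RightComoduleAlgebra.coact (R := R) (H := H) b))
    (fun f g b => by simp [LinearMap.lTensor_add]) (fun r f b => by simp [LinearMap.lTensor_smul])
    (fun f b c => by simp) (fun r f b => by simp)

theorem rightTwistMap_apply (f : U.toSubalgebra) (b : B) : rightTwistMap U B f b =
    (U.act f).lTensor B (RightComoduleAlgebra.coact (R := R) (H := H) b) := rfl

theorem rightTwistMap_eq (f : U.toSubalgebra) : rightTwistMap U B f =
    (U.act f).lTensor B ∘ₗ
      (RightComoduleAlgebra.coact (R := R) (H := H) (B := B)).toLinearMap := rfl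

theorem rightTwistMap_one_left (b : B) : rightTwistMap U B 1 b = b ⊗ₜ 1 := by
  have h1 : U.act 1 = LinearMap.toSpanSingleton R _ 1 ∘ₗ Coalgebra.counit := by
    ext h : 2
    exact rightReg_one h
  have h2 : ∀ s : B ⊗[R] H, (U.act 1).lTensor B s =
      TensorProduct.rid R B (Coalgebra.counit.lTensor B s) ⊗ₜ 1 := by
    intro s
    induction s with
    | zero => simp
    | add s t hs ht => simp only [map_add, hs, ht, TensorProduct.add_tmul]
    | tmul c h => simp [h1, TensorProduct.smul_tmul]
  rw [rightTwistMap_apply, h2, RightComoduleAlgebra.counit]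

theorem rightTwistMap_mul_left (f g : U.toSubalgebra) (b : B) :
    rightTwistMap U B (f * g) b =
      extendRight (R := R) (X := B) (Y := U.toSubalgebra) (rightTwistMap U B f) (rightTwistMap U B g b) := by
  let G : H ⊗[R] H →ₗ[R] U.toSubalgebra :=
    LinearMap.mul' R U.toSubalgebra ∘ₗ TensorProduct.map (U.act f) (U.act g)
  have h1 : U.act (f * g) = G ∘ₗ Coalgebra.comul := by
    ext h : 2
    have h0 : ∀ s : H ⊗[R] H, (G s : ConvDual R H) = LinearMap.mul' R (ConvDual R H)
        (TensorProduct.map (rightReg R H f) (rightReg R H g) s) := by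
      intro s
      induction s with
      | zero => simp
      | add s t hs ht => simp [hs, ht]
      | tmul u v => simp [G]
    rw [LinearMap.comp_apply, h0, ← rightReg_convMul]
    rfl
  have h2 : ∀ s : B ⊗[R] H,
      extendRight (R := R) (X := B) (Y := U.toSubalgebra) (LinearMap.lTensor B (U.act f) ∘ₗ
          (RightComoduleAlgebra.coact (R := R) (H := H) (B := B)).toLinearMap)
        ((U.act g).lTensor B s) =
      G.lTensor B (TensorProduct.assoc R B H H
        ((RightComoduleAlgebra.coact (R := R) (H := H) (B := B)).toLinearMap.rTensor H s)) := by
    intro s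
    induction s with
    | zero => simp
    | add s t hs ht => simp only [map_add, hs, ht]
    | tmul c h =>
      rw [LinearMap.lTensor_tmul, extendRight_tmul, LinearMap.rTensor_tmul, LinearMap.comp_apply]
      generalize (RightComoduleAlgebra.coact (R := R) (H := H) (B := B)).toLinearMap c = t
      induction t with
      | zero => simp
      | add t t' ht ht' => simp only [map_add, add_mul, ht, ht', TensorProduct.add_tmul]
      | tmul p q => simp [G]
  rw [rightTwistMap_eq U B f, rightTwistMap_apply, rightTwistMap_apply, h1, LinearMap.lTensor_comp, LinearMap.comp_apply,
    ← RightComoduleAlgebra.coassoc, ← h2]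

theorem rightTwistMap_mul_right (f : U.toSubalgebra) (b c : B) :
    rightTwistMap U B f (b * c) =
      extendLeft (R := R) (X := B) (Y := U.toSubalgebra) ((rightTwistMap U B).flip c) (rightTwistMap U B f b) := by
  have key : ∀ s t : B ⊗[R] H, ∀ L : U.toSubalgebra →ₗ[R] B ⊗[R] U.toSubalgebra,
      (∀ g, L g = (U.act g).lTensor B t) →
      (U.act f).lTensor B (s * t) =
          extendLeft (R := R) (X := B) (Y := U.toSubalgebra) L ((U.act f).lTensor B s) := by
    intro s t L hL
    induction s with
    | zero => simp
    | add s s' hs hs' => simp only [map_add, add_mul, hs, hs']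
    | tmul p h =>
      rw [LinearMap.lTensor_tmul, extendLeft_tmul, hL]
      clear hL
      induction t with
      | zero => simp
      | add t t' ht ht' => simp only [map_add, mul_add, ht, ht']
      | tmul q k =>
        have : U.act f (h * k) = U.act (U.act f h) k := by
          ext : 1
          exact rightReg_mul _ _ _
        simp [this]
  rw [rightTwistMap_apply, map_mul, rightTwistMap_apply]
  exact key _ _ _ fun g => rfl

/-- The twisting map `f ⊗ b ↦ ∑ b₀ ⊗ f b₁`. -/
def rightTwist : TwistingMap R B U.toSubalgebra where
  toMap := rightTwistMap U B
  map_one_left := rightTwistMap_one_left U B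
  map_one_right f := by
    have : U.act f 1 = f := by
      ext l
      simp
    simp [rightTwistMap_apply, Algebra.TensorProduct.one_def, this]
  map_mul_left := rightTwistMap_mul_left U B
  map_mul_right := rightTwistMap_mul_right U B

/-- The right smash product `B # U`, with `(b # f)(c # g) = ∑ b c₀ # (f c₁) ⋆ g`. -/
abbrev RightSmash : Type max (max u v) w := TwistedTensor (rightTwist U B)

variable {B} in
theorem RightSmash.tmul_mul_tmul (b c : B) (f g : U.toSubalgebra) {ι : Type*} (s : Finset ι)
    (c₀ : ι → B) (c₁ : ι → H)
    (hs : RightComoduleAlgebra.coact (R := R) (H := H) c = ∑ i ∈ s, c₀ i ⊗ₜ c₁ i) :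
    (TwistedTensor.tmul _ b f * TwistedTensor.tmul _ c g : RightSmash U B) =
      ∑ i ∈ s, TwistedTensor.tmul _ (b * c₀ i) (U.act f (c₁ i) * g) := by
  have : (b ⊗ₜ[R] (1 : U.toSubalgebra)) * ((rightTwist U B).toMap f c * (1 ⊗ₜ g)) =
      ∑ i ∈ s, (b * c₀ i) ⊗ₜ (U.act f (c₁ i) * g) := by
    simp [rightTwist, rightTwistMap_apply, hs, Finset.sum_mul, Finset.mul_sum]
  rw [TwistedTensor.tmul_mul_tmul, this, map_sum]
  rfl

end RightSmash

/-! ### The finite dual and its subbialgebras -/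

section FiniteDual

variable (R : Type u) [CommRing R] (H : Type v) [Ring H] [Bialgebra R H]

/-- The sub-bimodule `H f H` of `H*` generated by `f`. -/
def bimoduleSpan (f : ConvDual R H) : Submodule R (ConvDual R H) :=
  Submodule.span R {g | ∃ a b : H, g = rightReg R H (leftReg R H f a) b}

/-- The finite dual `H°` of all `f` for which `H f H` is a finitely generated `R`-module. -/
def finiteDual [IsNoetherianRing R] : Submodule R (ConvDual R H) where
  carrier := {f | (bimoduleSpan R H f).FG}
  zero_mem' := by
    have : bimoduleSpan R H 0 = ⊥ := by
      rw [bimoduleSpan, Submodule.span_eq_bot]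
      rintro _ ⟨a, b, rfl⟩
      simp
    simp only [Set.mem_ofPred_eq, this]
    exact Submodule.fg_bot
  add_mem' {f g} hf hg := by
    have := isNoetherian_of_fg_of_noetherian _ (Submodule.FG.sup hf hg)
    refine Submodule.FG.of_le (Submodule.FG.sup hf hg) ?_
    rw [bimoduleSpan, Submodule.span_le]
    rintro _ ⟨a, b, rfl⟩
    simp only [map_add, LinearMap.add_apply]
    exact Submodule.add_mem_sup (Submodule.subset_span ⟨a, b, rfl⟩)
      (Submodule.subset_span ⟨a, b, rfl⟩)
  smul_mem' r f hf := by
    refine Submodule.FG.of_le hf ?_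
    rw [bimoduleSpan, Submodule.span_le]
    rintro _ ⟨a, b, rfl⟩
    simp only [map_smul, LinearMap.smul_apply]
    exact Submodule.smul_mem _ _ (Submodule.subset_span ⟨a, b, rfl⟩)

/-- The inclusion of `H*` into the module `R^H` of all functions `H → R`. -/
def toFunction : ConvDual R H →ₗ[R] (H → R) :=
  LinearMap.ltoFun R H R R ∘ₗ (WithConv.linearEquiv R (H →ₗ[R] R)).toLinearMap

/-- `H` is an `α`-algebra if `H°` is a pure submodule of `R^H`. -/
def IsAlphaAlgebra [IsNoetherianRing R] : Prop :=
  IsPure ((finiteDual R H).map (toFunction R H))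

/-- The pairing `(f ⊗ g)(h, k) = f(h) g(k)`. -/
def dualPairing : ConvDual R H ⊗[R] ConvDual R H →ₗ[R] H →ₗ[R] H →ₗ[R] R :=
  TensorProduct.lift (LinearMap.mk₂ R
    (fun f g => (LinearMap.mul R R).compl₁₂ f.ofConv g.ofConv)
    (fun f f' g => by ext; simp [LinearMap.add_apply])
    (fun r f g => by ext; simp [mul_assoc])
    (fun f g g' => by ext; simp [mul_add]) (fun r f g => by ext; simp [mul_left_comm]))

@[simp]
theorem dualPairing_tmul (f g : ConvDual R H) (h k : H) :
    dualPairing R H (f ⊗ₜ g) h k = f h * g k := rfl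

/-- An `R`-subbialgebra `U ⊆ H°`: a subalgebra of `H*` (for convolution, containing `ε`) that is
contained in `H°`, is pure in `H°` and satisfies `Δ(U) ⊆ U ⊗ U`.  Here the
comultiplication of `H°` is given by `Δ(f) = ∑ f₁ ⊗ f₂` where `f(h k) = ∑ f₁(h) f₂(k)`; its counit
is `f ↦ f(1)`. -/
structure SubBialgebra [IsNoetherianRing R] extends Subalgebra R (ConvDual R H) where
  le_finiteDual : Subalgebra.toSubmodule toSubalgebra ≤ finiteDual R H
  pure : IsPure (M := finiteDual R H)
    ((Subalgebra.toSubmodule toSubalgebra).submoduleOf (finiteDual R H))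
  comul_mem : ∀ f : toSubalgebra, ∃ t : toSubalgebra ⊗[R] toSubalgebra, ∀ h k : H,
    dualPairing R H (TensorProduct.map toSubalgebra.val.toLinearMap
      toSubalgebra.val.toLinearMap t) h k = (f : ConvDual R H) (h * k)

variable {R H}

/-- A subbialgebra of `H°` is stable under the right regular action: `f h = ∑ f₁(h) f₂`. -/
theorem SubBialgebra.rightReg_mem [IsNoetherianRing R] (U : SubBialgebra R H) (f : ConvDual R H)
    (hf : f ∈ U.toSubalgebra) (h : H) : rightReg R H f h ∈ U.toSubalgebra := by
  obtain ⟨t, ht⟩ := U.comul_mem ⟨f, hf⟩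
  have key : ∀ t : U.toSubalgebra ⊗[R] U.toSubalgebra, ∃ g ∈ U.toSubalgebra, ∀ k,
      dualPairing R H (TensorProduct.map U.toSubalgebra.val.toLinearMap
        U.toSubalgebra.val.toLinearMap t) h k = g k := by
    intro t
    induction t with
    | zero => exact ⟨0, zero_mem _, fun k => by simp⟩
    | add s t hs ht =>
      obtain ⟨a, ha, ha'⟩ := hs
      obtain ⟨b, hb, hb'⟩ := ht
      exact ⟨a + b, add_mem ha hb, fun k => by simp [ha', hb']⟩
    | tmul a b => exact ⟨(a : ConvDual R H) h • (b : ConvDual R H),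
        Subalgebra.smul_mem _ b.2 _, fun k => by simp⟩
  obtain ⟨g, hg, hg'⟩ := key t
  have : rightReg R H f h = g := by
    ext k
    exact (ht h k).symm.trans (hg' k)
  rwa [this]

/-- A subbialgebra of `H°`, as a right `H`-module subalgebra of `H*`. -/
def SubBialgebra.toRightModuleSubalgebra [IsNoetherianRing R] (U : SubBialgebra R H) :
    RightModuleSubalgebra R H where
  toSubalgebra := U.toSubalgebra
  rightReg_mem := U.rightReg_mem

end FiniteDual

/-! ### Local finiteness, the induced coaction and its coefficients -/

section Coaction

variable {R : Type u} [CommRing R] {H : Type v} [Ring H] [Bialgebra R H]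
  (U : Subalgebra R (ConvDual R H))
  (A : Type w) [Ring A] [Algebra R A] [Module H A] [IsScalarTower R H A]

/-- `A` is `U`-locally finite: every `a` is annihilated by the common kernel of finitely many
elements of `U`. -/
def IsLocallyFinite : Prop :=
  ∀ a : A, ∃ s : Finset (ConvDual R H), (∀ f ∈ s, f ∈ U) ∧
    ∀ h : H, (∀ f ∈ s, f h = 0) → h • a = 0

/-- The canonical map `α : M ⊗ U → Hom(H, M)`, `m ⊗ f ↦ (h ↦ f(h) m)`. -/
def alphaMap (M : Type w) [AddCommGroup M] [Module R M] : M ⊗[R] U →ₗ[R] H →ₗ[R] M :=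
  TensorProduct.lift (LinearMap.mk₂ R
    (fun m f => (LinearMap.toSpanSingleton R M m) ∘ₗ (f : ConvDual R H).ofConv)
    (fun m n f => by ext; simp) (fun r m f => by ext h; exact smul_comm (f.1 h) r m)
    (fun m f g => by ext h; exact add_smul (f.1 h) (g.1 h) m)
    (fun r m f => by ext h; exact mul_smul r (f.1 h) m))

@[simp]
theorem alphaMap_tmul (M : Type w) [AddCommGroup M] [Module R M] (m : M) (f : U) (h : H) :
    alphaMap U M (m ⊗ₜ f) h = (f : ConvDual R H) h • m := rfl

variable {A}

/-- The right `U`-coaction `ϱ = α⁻¹ ∘ (a ↦ (h ↦ h a))` induced on a `U`-locally finite left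
`H`-module, i.e. `ϱ(a) = ∑ a₀ ⊗ a₁` where `h a = ∑ a₁(h) a₀`.  It is meant for the case that `α` is
injective and `a ↦ (h ↦ h a)` takes its values in the range of `α`. -/
def inducedCoaction (a : A) : A ⊗[R] U :=
  Function.invFun (alphaMap U A) (orbitMap R H a)

/-- A choice, for each `a`, of a finite expansion `ϱ(a) = ∑ a₀ ⊗ a₁` in `A ⊗ U`. -/
def IsExpansion (r : A → List (A × U)) : Prop :=
  ∀ a, inducedCoaction U a = ((r a).map fun p => p.1 ⊗ₜ[R] p.2).sum

/-- The coefficient module `Cf(A)`: the submodule of `H*` generated by the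
elements `a₁` that occur in the chosen expansions `ϱ(a) = ∑ a₀ ⊗ a₁`. -/
def Cf (r : A → List (A × U)) : Submodule R (ConvDual R H) :=
  Submodule.span R {g | ∃ a, ∃ p ∈ r a, (p.2 : ConvDual R H) = g}

end Coaction

/-! ### Twisted antipodes and the RL-condition -/

section RL

variable {R : Type u} [CommRing R] {H : Type v} [Ring H] [Bialgebra R H]

/-- `S` is a twisted antipode of `H`, i.e. an antipode of `H^op`:
`∑ S(h₂) h₁ = ε(h) 1 = ∑ h₂ S(h₁)`. -/
structure IsTwistedAntipode (S : H →ₗ[R] H) : Prop where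
  left : ∀ h : H, LinearMap.mul' R H (TensorProduct.comm R H H (S.lTensor H (Coalgebra.comul h))) =
    algebraMap R H (Coalgebra.counit h)
  right : ∀ h : H, LinearMap.mul' R H (TensorProduct.comm R H H (S.rTensor H (Coalgebra.comul h))) =
    algebraMap R H (Coalgebra.counit h)

/-- The dual map `S* : H* → H*`, `f ↦ f ∘ S`. -/
def dualMap (S : H →ₗ[R] H) : ConvDual R H →ₗ[R] ConvDual R H :=
  (WithConv.linearEquiv R (H →ₗ[R] R)).symm.toLinearMap ∘ₗ S.lcomp R R ∘ₗ
    (WithConv.linearEquiv R (H →ₗ[R] R)).toLinearMap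

variable (R H)

/-- The left action of `H*` on `H`: `f ⇀ k = ∑ k₁ f(k₂)`, linear in `f`. -/
def leftHit : ConvDual R H →ₗ[R] Module.End R H where
  toFun f := (TensorProduct.rid R H).toLinearMap ∘ₗ f.ofConv.lTensor H ∘ₗ Coalgebra.comul
  map_add' f g := by ext; simp [LinearMap.lTensor_add]
  map_smul' r f := by ext; simp [LinearMap.lTensor_smul]

/-- The map `ρ : H* → End(H)`, `g ↦ (k ↦ k ↼ g)`, where `k ↼ g = ∑ g(k₁) k₂`. -/
def rightHit : ConvDual R H →ₗ[R] Module.End R H where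
  toFun g := (TensorProduct.lid R H).toLinearMap ∘ₗ g.ofConv.rTensor H ∘ₗ Coalgebra.comul
  map_add' f g := by ext; simp [LinearMap.rTensor_add]
  map_smul' r f := by ext; simp [LinearMap.rTensor_smul]

variable {R H}

/-- The map `λ : H ⊗ U → End(H)`, `h ⊗ g ↦ (k ↦ h (g ⇀ k))`. -/
def leftRep (U : Subalgebra R (ConvDual R H)) : H ⊗[R] U →ₗ[R] Module.End R H :=
  TensorProduct.lift
    ((LinearMap.mul R (Module.End R H)).compl₁₂ (LinearMap.mul R H)
      (leftHit R H ∘ₗ U.val.toLinearMap))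

@[simp]
theorem leftRep_tmul (U : Subalgebra R (ConvDual R H)) (h : H) (g : U) (k : H) :
    leftRep U (h ⊗ₜ g) k = h * leftHit R H g k := rfl

/-- The RL-condition for `(V, U)`: the inclusion `ρ(V) ⊆ λ(H ⊗ U)`. -/
def RLCondition (V : Submodule R (ConvDual R H)) (U : Subalgebra R (ConvDual R H)) : Prop :=
  V.map (rightHit R H) ≤ LinearMap.range (leftRep U)

end RL

end

end HopfDuality

/-! Both algebras are realised as subalgebras of `Module.End R (A # H)`, and these two subalgebras
are shown to be equal.

Write f ⇀ k = ∑ k₁ f(k₂) and k ↼ g = ∑ g(k₁) k₂, put ρ(g)(k) = k ↼ g, and let λ(h ⊗ f) be the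
endomorphism k ↦ h (f ⇀ k). The algebra (A # H) # U acts on A # H by (b # f) c = ∑ b c₀ f(c₁)
(`smashRep`). On the other side H # U acts on H through λ, so A ⊗ (H # U) acts on A ⊗ H. The twisted
antipode S makes a ⊗ h ↦ (1 # h)(a # 1) a bijection A ⊗ H ≃ A # H (`smashEquiv`), and conjugation by
it moves this action to A # H (`tensorRep`).

Both actions are faithful. Evaluating at k₂ and multiplying on the right by S(k₁) recovers b ⊗ f ↦
f(k) b, because ∑ (f ⇀ k₂) S(k₁) = f(k) 1 (`injective_of_apply`). The resulting map M ⊗ U → Hom(H,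
M) is injective since U is pure in H°, H° is pure in R^H, and R is Noetherian
(`alphaMap_injective`).

The images agree (`range_smashRep`). Both contain 1 ⊗ λ(H ⊗ U) (`endRep_leftRep`). Left
multiplication by a # 1 is ∑ a₀ ⊗ ρ(S* a₁) (`mulLeft_eq_endRep`), and conversely a ⊗ 1 is ∑ (a₀ #
1)(1 ⊗ ρ(a₁)) (`endRep_eq_sum`). The RL-condition puts ρ(a₁) and ρ(S* a₁) into λ(H ⊗ U), so the
generators of each image lie in the other. -/

namespace HopfDuality

noncomputable section

/-! ### Injectivity and range of `M ⊗ U → Hom(H, M)` -/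

section Alpha

/-- The canonical map `M ⊗ R^X → M^X`. -/
def tensorFunMap (R X M : Type*) [CommRing R] [AddCommGroup M] [Module R M] :
    M ⊗[R] (X → R) →ₗ[R] X → M :=
  TensorProduct.lift (LinearMap.mk₂ R (fun m f x => f x • m)
    (fun m n f => by ext; simp) (fun r m f => by ext x; exact smul_comm (f x) r m)
    (fun m f g => by ext x; exact add_smul (f x) (g x) m)
    (fun r m f => by ext x; exact mul_smul r (f x) m))

@[simp]
theorem tensorFunMap_tmul {R X M : Type*} [CommRing R] [AddCommGroup M] [Module R M]
    (m : M) (f : X → R) (x : X) : tensorFunMap R X M (m ⊗ₜ f) x = f x • m := rfl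

/-- Over a Noetherian ring the canonical map `M ⊗ R^X → M^X` is injective. -/
theorem tensorFunMap_injective (R X M : Type*) [CommRing R] [IsNoetherianRing R] [AddCommGroup M]
    [Module R M] : Function.Injective (tensorFunMap R X M) := by
  rw [injective_iff_map_eq_zero]
  intro z hz
  obtain ⟨s, rfl⟩ := TensorProduct.exists_finset z
  -- For z = ∑ mᵢ ⊗ fᵢ, this is the module of linear relations among the mᵢ. It is finitely
  -- generated because R is Noetherian.
  let K : Submodule R (s → R) := LinearMap.ker (Fintype.linearCombination R fun i : s => i.1.1)
  obtain ⟨n, k, hk⟩ := Submodule.fg_iff_exists_fin_generating_family.1 (IsNoetherian.noetherian K)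
  -- Since z maps to zero, the values (fᵢ(x))ᵢ form a relation for every x, hence a combination of
  -- the finitely many generators kⱼ. Its coefficients, as functions of x, allow the kⱼ to be moved
  -- across the tensor sign, where they kill the mᵢ.
  have hK : ∀ x : X, ∃ c : Fin n → R, ∑ j, c j • k j = fun i : s => i.1.2 x := by
    intro x
    rw [← Submodule.mem_span_range_iff_exists_fun, hk, LinearMap.mem_ker,
      Fintype.linearCombination_apply, Finset.sum_coe_sort s fun i => i.2 x • i.1]
    simpa [Finset.sum_apply] using congrFun hz x
  choose c hc using hK
  have hk0 : ∀ j, ∑ i : s, k j i • i.1.1 = 0 := by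
    intro j
    have : k j ∈ K := hk ▸ Submodule.subset_span ⟨j, rfl⟩
    rwa [LinearMap.mem_ker, Fintype.linearCombination_apply] at this
  have h2 : ∀ i : s, i.1.2 = ∑ j, k j i • fun x => c x j := by
    intro i
    ext x
    rw [← congrFun (hc x) i]
    simp [Finset.sum_apply, mul_comm]
  calc ∑ i ∈ s, i.1 ⊗ₜ[R] i.2 = ∑ i : s, i.1.1 ⊗ₜ[R] i.1.2 :=
        (Finset.sum_coe_sort s fun i => i.1 ⊗ₜ[R] i.2).symm
    _ = ∑ i : s, ∑ j, (k j i • i.1.1) ⊗ₜ[R] (fun x => c x j) := by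
        refine Finset.sum_congr rfl fun i _ => ?_
        conv_lhs => rw [h2 i]
        simp only [TensorProduct.tmul_sum, TensorProduct.smul_tmul]
    _ = ∑ j, (∑ i : s, k j i • i.1.1) ⊗ₜ[R] (fun x => c x j) := by
        rw [Finset.sum_comm]
        simp only [TensorProduct.sum_tmul]
    _ = 0 := by simp only [hk0, TensorProduct.zero_tmul, Finset.sum_const_zero]

variable {R : Type*} [CommRing R] {H : Type*} [Ring H] [Bialgebra R H]

/-- The map factors as M ⊗ U → M ⊗ H° → M ⊗ R^H → M^H. The first two arrows are injective by purity,
the last by `tensorFunMap_injective`. -/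
theorem SubBialgebra.alphaMap_injective [IsNoetherianRing R] (hH : IsAlphaAlgebra R H)
    (U : SubBialgebra R H) (M : Type*) [AddCommGroup M] [Module R M] :
    Function.Injective (alphaMap U.toSubalgebra M) := by
  let e₁ : U.toSubalgebra ≃ₗ[R]
      (Subalgebra.toSubmodule U.toSubalgebra).submoduleOf (finiteDual R H) :=
    (Submodule.submoduleOfEquivOfLe U.le_finiteDual).symm
  have hinj : Function.Injective (toFunction R H) := by
    intro f g h
    ext x
    exact congrFun h x
  let e₂ := Submodule.equivMapOfInjective (toFunction R H) hinj (finiteDual R H)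
  have h : (DFunLike.coe : (H →ₗ[R] M) → H → M) ∘ alphaMap U.toSubalgebra M =
      tensorFunMap R H M ∘ (Submodule.subtype _).lTensor M ∘ e₂.toLinearMap.lTensor M ∘
        (Submodule.subtype _).lTensor M ∘ e₁.toLinearMap.lTensor M := by
    ext z x
    simp only [Function.comp_apply]
    induction z with
    | zero => simp
    | add a b ha hb => simp only [map_add, LinearMap.add_apply, Pi.add_apply, ha, hb]
    | tmul m f => rfl
  refine Function.Injective.of_comp (f := (DFunLike.coe : (H →ₗ[R] M) → H → M)) ?_
  rw [h]
  exact (tensorFunMap_injective R H M).comp <| (IsPure.lTensor_injective hH M).comp <|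
    (LinearEquiv.lTensor M e₂).injective.comp <| (IsPure.lTensor_injective U.pure M).comp
      (LinearEquiv.lTensor M e₁).injective

theorem alphaMap_naturality (U : Subalgebra R (ConvDual R H)) {M N : Type*} [AddCommGroup M]
    [Module R M] [AddCommGroup N] [Module R N] (φ : M →ₗ[R] N) (z : M ⊗[R] U) :
    alphaMap U N (φ.rTensor U z) = φ ∘ₗ alphaMap U M z := by
  induction z with
  | zero => simp
  | add a b ha hb => simp only [map_add, ha, hb, LinearMap.comp_add]
  | tmul m f => ext h; simp

/-- If a linear map `φ : H → M` vanishes on the common kernel of finitely many elements of `U`,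
then it lies in the image of `M ⊗ U`. -/
theorem mem_range_alphaMap (U : Subalgebra R (ConvDual R H))
    (hU : ∀ (n : ℕ) (K : Submodule R (Fin n → R)),
      Function.Injective (alphaMap U ((Fin n → R) ⧸ K)))
    {M : Type*} [AddCommGroup M] [Module R M] (φ : H →ₗ[R] M) (s : Finset (ConvDual R H))
    (hs : ∀ f ∈ s, f ∈ U) (hφ : ∀ h : H, (∀ f ∈ s, f h = 0) → φ h = 0) :
    φ ∈ LinearMap.range (alphaMap U M) := by
  let f : Fin s.card → U := fun i => ⟨s.equivFin.symm i, hs _ (s.equivFin.symm i).2⟩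
  -- The map φ kills ker `ev`, so it factors through the image `I` of `ev`. It then suffices to lift
  -- `ev`, as a map to `I`, to an element of I ⊗ U.
  let ev : H →ₗ[R] Fin s.card → R := LinearMap.pi fun i => (f i : ConvDual R H).ofConv
  let I := LinearMap.range ev
  have hker : LinearMap.ker ev ≤ LinearMap.ker φ := by
    intro h hh
    refine hφ h fun g hg => ?_
    simpa [ev, f] using congrFun (LinearMap.mem_ker.1 hh) (s.equivFin ⟨g, hg⟩)
  obtain ⟨ψ, hψ⟩ : ∃ ψ : I →ₗ[R] M, ψ ∘ₗ ev.rangeRestrict = φ := by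
    refine ⟨(LinearMap.ker ev).liftQ φ hker ∘ₗ ev.quotKerEquivRange.symm.toLinearMap, ?_⟩
    ext h
    have : ev.rangeRestrict h = ev.quotKerEquivRange (Submodule.Quotient.mk h) := rfl
    simp [this]
  let x : (Fin s.card → R) ⊗[R] U := ∑ i, Pi.single i 1 ⊗ₜ f i
  have hx : alphaMap U _ x = ev := by
    ext h j
    simp [x, ev, LinearMap.sum_apply, Finset.sum_apply, Pi.single_apply]
  -- The lift `x` of `ev` to Rⁿ ⊗ U comes from I ⊗ U: its image in (Rⁿ/I) ⊗ U gives the zero map, so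
  -- it vanishes by injectivity for Rⁿ/I, and right exactness of the tensor product applies.
  have hx0 : I.mkQ.rTensor U x = 0 := by
    apply hU
    rw [alphaMap_naturality, hx, map_zero]
    ext h
    simp [I]
  obtain ⟨y, hy⟩ := (rTensor_exact U (f := I.subtype) (g := I.mkQ)
    (LinearMap.exact_subtype_mkQ I) I.mkQ_surjective x).1 hx0
  refine ⟨ψ.rTensor U y, ?_⟩
  rw [alphaMap_naturality, ← hψ]
  congr 1
  ext h : 1
  apply Subtype.ext
  rw [← hy, alphaMap_naturality] at hx
  exact LinearMap.congr_fun hx h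

end Alpha

/-! ### The defining formula of the induced coaction. -/

section Coefficients

variable {R : Type*} [CommRing R] [IsNoetherianRing R] {H : Type*} [Ring H] [Bialgebra R H]
  {A : Type*} [Ring A] [Algebra R A] [Module H A] [IsScalarTower R H A]

/-- `inducedCoaction` is defined by `Function.invFun`, so it is a true preimage only once the orbit
map is known to lie in the range; local finiteness gives this. -/
theorem alphaMap_inducedCoaction (hH : IsAlphaAlgebra R H) (U : SubBialgebra R H)
    (hA : IsLocallyFinite U.toSubalgebra A) (a : A) :
    alphaMap U.toSubalgebra A (inducedCoaction U.toSubalgebra a) = orbitMap R H a := by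
  obtain ⟨s, hs, h⟩ := hA a
  exact Function.invFun_eq <| mem_range_alphaMap U.toSubalgebra
    (fun n K => U.alphaMap_injective hH _) (orbitMap R H a) s hs h

/-- `h a = ∑ a₁(h) a₀` for a chosen expansion of the induced coaction. -/
theorem smul_eq_sum_expansion (hH : IsAlphaAlgebra R H) (U : SubBialgebra R H)
    (hA : IsLocallyFinite U.toSubalgebra A) {r : A → List (A × U.toSubalgebra)}
    (hr : IsExpansion U.toSubalgebra r) (h : H) (a : A) :
    h • a = ((r a).map fun p => (p.2 : ConvDual R H) h • p.1).sum := by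
  rw [← orbitMap_apply R, ← alphaMap_inducedCoaction hH U hA, hr a, map_list_sum,
    ← LinearMap.applyₗ_apply_apply (R := R) h, map_list_sum, List.map_map, List.map_map]
  rfl

end Coefficients

/-! ### The factors of a twisted tensor product -/

namespace TwistedTensor

variable {R X Y : Type*} [CommRing R] [Ring X] [Algebra R X] [Ring Y] [Algebra R Y]
  (T : TwistingMap R X Y)

theorem tmul_one_mul_tmul (x x' : X) (y : Y) :
    tmul T x 1 * tmul T x' y = tmul T (x * x') y := by
  rw [tmul_mul_tmul, T.map_one_left]
  simp [ofTensor_tmul]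

theorem tmul_mul_one_tmul (x : X) (y y' : Y) :
    tmul T x y * tmul T 1 y' = tmul T x (y * y') := by
  rw [tmul_mul_tmul, T.map_one_right]
  simp [ofTensor_tmul]

/-- The inclusion `y ↦ 1 ⊗ y` of the right factor. -/
def includeRight : Y →ₐ[R] TwistedTensor T :=
  AlgHom.ofLinearMap ((ofTensor T).toLinearMap ∘ₗ TensorProduct.mk R X Y 1) rfl
    fun y y' => (tmul_mul_one_tmul T 1 y y').symm

end TwistedTensor

/-! ### The action of `B # U` on `B` -/

section Representation

variable {R : Type*} [CommRing R] {H : Type*} [Ring H] [Bialgebra R H]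

section

variable (R H) (B : Type*) [Ring B] [Algebra R B] [RightComoduleAlgebra R H B]

/-- The action `f ⇀ b = ∑ b₀ f(b₁)` of `H*` on a right `H`-comodule algebra. -/
def coactHit : ConvDual R H →ₗ[R] Module.End R B where
  toFun f := (TensorProduct.rid R B).toLinearMap ∘ₗ f.ofConv.lTensor B ∘ₗ
    (RightComoduleAlgebra.coact (R := R) (H := H) (B := B)).toLinearMap
  map_add' f g := by ext; simp [LinearMap.lTensor_add]
  map_smul' r f := by ext; simp [LinearMap.lTensor_smul]

end

variable {B : Type*} [Ring B] [Algebra R B] [RightComoduleAlgebra R H B]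

theorem coactHit_apply (f : ConvDual R H) (b : B) : coactHit R H B f b =
    TensorProduct.rid R B (f.ofConv.lTensor B (RightComoduleAlgebra.coact (R := R) b)) := rfl

/-- By coassociativity both sides are ∑ b₀ ⊗ b₁ g(b₂). -/
theorem coact_coactHit (g : ConvDual R H) (b : B) :
    RightComoduleAlgebra.coact (R := R) (H := H) (coactHit R H B g b) =
      (leftHit R H g).lTensor B (RightComoduleAlgebra.coact (R := R) b) := by
  have h1 : leftHit R H g =
      ((TensorProduct.rid R H).toLinearMap ∘ₗ g.ofConv.lTensor H) ∘ₗ Coalgebra.comul := rfl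
  rw [h1, LinearMap.lTensor_comp, LinearMap.comp_apply, ← RightComoduleAlgebra.coassoc,
    coactHit_apply]
  generalize RightComoduleAlgebra.coact (R := R) (H := H) b = u
  induction u with
  | zero => simp
  | add u v hu hv => simp only [map_add, hu, hv]
  | tmul c h =>
    rw [LinearMap.lTensor_tmul, TensorProduct.rid_tmul, map_smul, LinearMap.rTensor_tmul]
    change _ • RightComoduleAlgebra.coact c = LinearMap.lTensor B _
      (TensorProduct.assoc R B H H (RightComoduleAlgebra.coact (R := R) (H := H) c ⊗ₜ h))
    generalize RightComoduleAlgebra.coact (R := R) (H := H) c = s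
    induction s with
    | zero => simp
    | add s t hs ht => simp only [smul_add, hs, ht, TensorProduct.add_tmul, map_add]
    | tmul d l => simp

theorem convMul_rightReg (f g : ConvDual R H) (h l : H) :
    (rightReg R H f h * g) l = f (h * leftHit R H g l) := by
  have : ∀ s : H ⊗[R] H, LinearMap.mul' R R (TensorProduct.map (rightReg R H f h).ofConv g.ofConv s)
      = f (h * TensorProduct.rid R H (g.ofConv.lTensor H s)) := by
    intro s
    induction s with
    | zero => simp
    | add s t hs ht => simp only [map_add, hs, ht, mul_add]
    | tmul p q => simp [mul_comm]
  exact this _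

/-- The map `b ⊗ f ↦ (c ↦ b (f ⇀ c))`. -/
def smashRepMap (U : Subalgebra R (ConvDual R H)) : B ⊗[R] U →ₗ[R] Module.End R B :=
  TensorProduct.lift
    ((LinearMap.mul R (Module.End R B)).compl₁₂ (LinearMap.mul R B)
      (coactHit R H B ∘ₗ U.val.toLinearMap))

@[simp]
theorem smashRepMap_tmul (U : Subalgebra R (ConvDual R H)) (b : B) (f : U) (c : B) :
    smashRepMap U (b ⊗ₜ f) c = b * coactHit R H B f c := rfl

theorem smashRepMap_mul_left (U : Subalgebra R (ConvDual R H)) (b : B) (z : B ⊗[R] U) (c : B) :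
    smashRepMap U ((b ⊗ₜ 1) * z) c = b * smashRepMap U z c := by
  induction z with
  | zero => simp
  | add z w hz hw => simp only [mul_add, map_add, LinearMap.add_apply, hz, hw]
  | tmul d f => simp [mul_assoc]

/-- This is the multiplicativity of the action of B # U. As the coaction is multiplicative, f ⇀ (c
(g ⇀ d)) = ∑ c₀ d₀ f(c₁ (g ⇀ d₁)), and f(c₁ (g ⇀ d₁)) = ((f c₁) ⋆ g)(d₁) by `convMul_rightReg`. -/
theorem smashRepMap_twist (U : RightModuleSubalgebra R H) (f g : U.toSubalgebra) (c d : B) :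
    smashRepMap U.toSubalgebra (rightTwistMap U B f c * (1 ⊗ₜ g)) d =
      coactHit R H B f (c * coactHit R H B g d) := by
  have key : ∀ s : B ⊗[R] H,
      smashRepMap U.toSubalgebra ((U.act f).lTensor B s * (1 ⊗ₜ g)) d =
        TensorProduct.rid R B (f.1.ofConv.lTensor B
          (s * (leftHit R H g).lTensor B (RightComoduleAlgebra.coact (R := R) d))) := by
    intro s
    induction s with
    | zero => simp
    | add s t hs ht => simp only [add_mul, map_add, LinearMap.add_apply, hs, ht]
    | tmul c h =>
      rw [LinearMap.lTensor_tmul, Algebra.TensorProduct.tmul_mul_tmul, mul_one, smashRepMap_tmul,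
        coactHit_apply]
      generalize RightComoduleAlgebra.coact (R := R) (H := H) d = t
      induction t with
      | zero => simp
      | add t t' ht ht' => simp only [mul_add, map_add, ht, ht']
      | tmul e l =>
        have := convMul_rightReg (f : ConvDual R H) (g : ConvDual R H) h l
        simp [this]
  rw [rightTwistMap_apply, key, ← coact_coactHit, ← map_mul]
  rfl

/-- The action of the right smash product `B # U` on `B`, `(b # f) c = ∑ b c₀ f(c₁)`. -/
def smashRep (U : RightModuleSubalgebra R H) : RightSmash U B →ₐ[R] Module.End R B :=
  AlgHom.ofLinearMap
    (smashRepMap U.toSubalgebra ∘ₗ (TwistedTensor.ofTensor (rightTwist U B)).symm.toLinearMap)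
    (by
      ext c
      change (1 : B) * coactHit R H B 1 c = c
      rw [one_mul, coactHit_apply]
      exact RightComoduleAlgebra.counit c)
    (by
      intro x y
      obtain ⟨x, rfl⟩ := (TwistedTensor.ofTensor _).surjective x
      obtain ⟨y, rfl⟩ := (TwistedTensor.ofTensor _).surjective y
      ext d
      rw [TwistedTensor.ofTensor_mul, Module.End.mul_apply]
      simp only [LinearMap.comp_apply, LinearEquiv.coe_coe, LinearEquiv.symm_apply_apply]
      induction x with
      | zero => simp
      | add x x' hx hx' => simp only [map_add, LinearMap.add_apply, hx, hx']
      | tmul b f =>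
        induction y with
        | zero => simp
        | add y y' hy hy' => simp only [map_add, LinearMap.add_apply, hy, hy']
        | tmul c g =>
          rw [TwistedTensor.mulMap_tmul, extendRight_tmul, smashRepMap_mul_left]
          exact congrArg (b * ·) (smashRepMap_twist U f g c d))

theorem smashRep_ofTensor (U : RightModuleSubalgebra R H) (z : B ⊗[R] U.toSubalgebra) :
    smashRep U (TwistedTensor.ofTensor (rightTwist U B) z) = smashRepMap U.toSubalgebra z := rfl

end Representation

/-! ### Consequences of a twisted antipode -/

section TwistedAntipode

variable {R : Type*} [CommRing R] {H : Type*} [Ring H] [Bialgebra R H]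

/-- Coassociativity and the counit axiom give ∑ m(h₁ ⊗ h₂) ⊗ h₃ = ∑ ε(h₁) 1 ⊗ h₂ = 1 ⊗ h. It is
applied to the two maps m that express the twisted antipode axioms. -/
theorem rTensor_assoc_symm_lTensor_comul (m : H ⊗[R] H →ₗ[R] H)
    (hm : ∀ h, m (Coalgebra.comul h) = algebraMap R H (Coalgebra.counit h)) (h : H) :
    m.rTensor H ((TensorProduct.assoc R H H H).symm
      (Coalgebra.comul.lTensor H (Coalgebra.comul h))) = 1 ⊗ₜ h := by
  have : m ∘ₗ Coalgebra.comul = Algebra.linearMap R H ∘ₗ Coalgebra.counit := by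
    ext h; simp [hm]
  rw [Coalgebra.coassoc_symm_apply, ← LinearMap.comp_apply, ← LinearMap.rTensor_comp, this,
    LinearMap.rTensor_comp, LinearMap.comp_apply, Coalgebra.rTensor_counit_comul]
  simp

variable {S : H →ₗ[R] H}

/-- `∑ (g ⇀ k₂) S(k₁) = g(k) 1`. -/
theorem IsTwistedAntipode.sum_leftHit_mul (hS : IsTwistedAntipode S) (g : ConvDual R H) (k : H) :
    LinearMap.mul' R H (TensorProduct.comm R H H
      (TensorProduct.map S (leftHit R H g) (Coalgebra.comul k))) = g k • 1 := by
  -- For s = Δ(k) the left side is ∑ k₂ g(k₃) S(k₁); regrouping exposes the factor ∑ k₂ S(k₁), which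
  -- collapses to the counit.
  have key : ∀ s : H ⊗[R] H, LinearMap.mul' R H (TensorProduct.comm R H H
      (TensorProduct.map S (leftHit R H g) s)) =
      TensorProduct.rid R H (g.ofConv.lTensor H
        ((LinearMap.mul' R H ∘ₗ (TensorProduct.comm R H H).toLinearMap ∘ₗ S.rTensor H).rTensor H
          ((TensorProduct.assoc R H H H).symm (Coalgebra.comul.lTensor H s)))) := by
    intro s
    induction s with
    | zero => simp
    | add s t hs ht => simp only [map_add, hs, ht]
    | tmul p q =>
      rw [TensorProduct.map_tmul, TensorProduct.comm_tmul, LinearMap.mul'_apply,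
        LinearMap.lTensor_tmul]
      change TensorProduct.rid R H (g.ofConv.lTensor H (Coalgebra.comul q)) * _ = _
      generalize (Coalgebra.comul q : H ⊗[R] H) = t
      induction t with
      | zero => simp
      | add t t' ht ht' => simp only [map_add, add_mul, TensorProduct.tmul_add, ht, ht']
      | tmul u v => simp
  rw [key, rTensor_assoc_symm_lTensor_comul _ hS.right]
  simp

/-- Elements of `B ⊗ U` are determined by the maps `b ⊗ f ↦ (k ↦ ∑ b j(k₁) f(k₂))`. -/
theorem IsTwistedAntipode.injective_of_apply (hS : IsTwistedAntipode S)
    (U : Subalgebra R (ConvDual R H)) {B : Type*} [Ring B]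
    [Algebra R B] (hU : Function.Injective (alphaMap U B)) (j : H →ₐ[R] B)
    {E : Type*} [AddCommGroup E] [Module R E] (Φ : B ⊗[R] U →ₗ[R] E) (ev : E →ₗ[R] H →ₗ[R] B)
    (hΦ : ∀ b f k, ev (Φ (b ⊗ₜ f)) k = b * j (leftHit R H f k)) : Function.Injective Φ := by
  -- W(T)(k) = ∑ T(k₂) j(S(k₁)). For T = b j(f ⇀ ·) this is b j(∑ (f ⇀ k₂) S(k₁)) = f(k) b, so W ∘
  -- ev ∘ Φ is the injective map `alphaMap`.
  let W : (H →ₗ[R] B) → H →ₗ[R] B := fun T => LinearMap.mul' R B ∘ₗ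
    (TensorProduct.comm R B B).toLinearMap ∘ₗ
      TensorProduct.map (j.toLinearMap ∘ₗ S) T ∘ₗ Coalgebra.comul
  have hW : ∀ T T', W (T + T') = W T + W T' := by
    intro T T'
    ext
    simp [W, TensorProduct.map_add_right]
  have h : (fun z => W (ev (Φ z))) = alphaMap U B := by
    ext z k
    induction z with
    | zero => simp [W]
    | add x y hx hy => simp only [map_add, hW, LinearMap.add_apply, hx, hy]
    | tmul b f =>
      have h1 : ev (Φ (b ⊗ₜ f)) = LinearMap.mulLeft R b ∘ₗ j.toLinearMap ∘ₗ leftHit R H f := by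
        ext k
        simp [hΦ]
      have h2 : ∀ s : H ⊗[R] H, LinearMap.mul' R B (TensorProduct.comm R B B
          (TensorProduct.map (j.toLinearMap ∘ₗ S)
            (LinearMap.mulLeft R b ∘ₗ j.toLinearMap ∘ₗ leftHit R H f) s)) =
          b * j (LinearMap.mul' R H (TensorProduct.comm R H H
            (TensorProduct.map S (leftHit R H f) s))) := by
        intro s
        induction s with
        | zero => simp
        | add s t hs ht => simp only [map_add, mul_add, hs, ht]
        | tmul p q => simp [mul_assoc]
      rw [h1]
      refine (h2 (Coalgebra.comul k)).trans ?_
      rw [hS.sum_leftHit_mul]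
      simp
  rw [← h] at hU
  exact Function.Injective.of_comp (f := fun e => W (ev e)) hU

end TwistedAntipode

/-! ### The decomposition `A # H = H A` -/

section Decomposition

variable {R : Type*} [CommRing R] {H : Type*} [Ring H] [Bialgebra R H]

/-- The map `a ⊗ h ↦ (u ↦ u₁ a ⊗ u₂) (L h)`. -/
def actAlong (A : Type*) [Ring A] [Algebra R A] [Module H A] [IsScalarTower R H A]
    (L : H →ₗ[R] H ⊗[R] H) : A ⊗[R] H →ₗ[R] A ⊗[R] H :=
  TensorProduct.lift (actFirst R H A ∘ₗ L).flip

variable {A : Type*} [Ring A] [Algebra R A] [Module H A] [IsScalarTower R H A]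

@[simp]
theorem actAlong_tmul (L : H →ₗ[R] H ⊗[R] H) (a : A) (h : H) :
    actAlong A L (a ⊗ₜ h) = actFirst R H A (L h) a := rfl

/-- The coaction turns the action on the first leg into a contraction: ∑ T(u) a ⊗ v = ∑ a₀ ⊗
a₁(T(u)) v. For s = Δ(k), the case T = S produces k ↼ S* a₁ and the case T = id produces k ↼ a₁. -/
theorem actFirst_eq_sum (U : Subalgebra R (ConvDual R H)) (l : List (A × U)) (a : A)
    (hl : ∀ h : H, h • a = (l.map fun p => (p.2 : ConvDual R H) h • p.1).sum)
    (T : H →ₗ[R] H) (s : H ⊗[R] H) :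
    actFirst R H A (T.rTensor H s) a =
      (l.map fun p => p.1 ⊗ₜ[R]
        TensorProduct.lid R H (((p.2 : ConvDual R H).ofConv ∘ₗ T).rTensor H s)).sum := by
  induction s with
  | zero => simp
  | add s t hs ht =>
    simp only [map_add, LinearMap.add_apply, hs, ht, TensorProduct.tmul_add, List.sum_map_add]
  | tmul u v =>
    rw [LinearMap.rTensor_tmul, actFirst_tmul, hl]
    generalize l = l'
    induction l' with
    | nil => simp
    | cons p l' ih => simp [TensorProduct.add_tmul, ih, TensorProduct.smul_tmul]

variable {S : H →ₗ[R] H}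

/-- The composite sends a ⊗ h to ∑ h₂ S(h₁) a ⊗ h₃, which is a ⊗ h by the axiom `right`. -/
theorem IsTwistedAntipode.actAlong_comul (hS : IsTwistedAntipode S) (z : A ⊗[R] H) :
    actAlong A Coalgebra.comul (actAlong A (S.rTensor H ∘ₗ Coalgebra.comul) z) = z := by
  have key : ∀ (a : A) (s : H ⊗[R] H),
      actAlong A Coalgebra.comul (actFirst R H A (S.rTensor H s) a) =
      actFirst R H A
        ((LinearMap.mul' R H ∘ₗ (TensorProduct.comm R H H).toLinearMap ∘ₗ S.rTensor H).rTensor H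
          ((TensorProduct.assoc R H H H).symm (Coalgebra.comul.lTensor H s))) a := by
    intro a s
    induction s with
    | zero => simp
    | add s t hs ht => simp only [map_add, LinearMap.add_apply, hs, ht]
    | tmul p q =>
      simp only [LinearMap.rTensor_tmul, actFirst_tmul, actAlong_tmul, LinearMap.lTensor_tmul]
      generalize (Coalgebra.comul q : H ⊗[R] H) = t
      induction t with
      | zero => simp
      | add t t' ht ht' =>
        simp only [map_add, LinearMap.add_apply, TensorProduct.tmul_add, ht, ht']
      | tmul u v => simp [mul_smul]
  induction z with
  | zero => simp
  | add z w hz hw => simp only [map_add, hz, hw]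
  | tmul a h =>
    rw [actAlong_tmul, LinearMap.comp_apply, key, rTensor_assoc_symm_lTensor_comul _ hS.right]
    simp

/-- The composite sends a ⊗ h to ∑ S(h₂) h₁ a ⊗ h₃, which is a ⊗ h by the axiom `left`. -/
theorem IsTwistedAntipode.actAlong_rTensor_comul (hS : IsTwistedAntipode S) (z : A ⊗[R] H) :
    actAlong A (S.rTensor H ∘ₗ Coalgebra.comul) (actAlong A Coalgebra.comul z) = z := by
  have key : ∀ (a : A) (s : H ⊗[R] H),
      actAlong A (S.rTensor H ∘ₗ Coalgebra.comul) (actFirst R H A s a) =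
      actFirst R H A
        ((LinearMap.mul' R H ∘ₗ (TensorProduct.comm R H H).toLinearMap ∘ₗ S.lTensor H).rTensor H
          ((TensorProduct.assoc R H H H).symm (Coalgebra.comul.lTensor H s))) a := by
    intro a s
    induction s with
    | zero => simp
    | add s t hs ht => simp only [map_add, LinearMap.add_apply, hs, ht]
    | tmul p q =>
      simp only [actFirst_tmul, actAlong_tmul, LinearMap.lTensor_tmul, LinearMap.comp_apply]
      generalize (Coalgebra.comul q : H ⊗[R] H) = t
      induction t with
      | zero => simp
      | add t t' ht ht' =>
        simp only [map_add, LinearMap.add_apply, TensorProduct.tmul_add, ht, ht']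
      | tmul u v => simp [mul_smul]
  induction z with
  | zero => simp
  | add z w hz hw => simp only [map_add, hz, hw]
  | tmul a h =>
    rw [actAlong_tmul, key, rTensor_assoc_symm_lTensor_comul _ hS.left]
    simp

variable [IsModuleAlgebra R H A]

/-- The isomorphism `A ⊗ H ≃ A # H`, `a ⊗ h ↦ (1 # h)(a # 1)`. -/
def IsTwistedAntipode.smashEquiv (hS : IsTwistedAntipode S) (A : Type*) [Ring A] [Algebra R A]
    [Module H A] [IsScalarTower R H A] [IsModuleAlgebra R H A] :
    A ⊗[R] H ≃ₗ[R] LeftSmash R H A :=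
  { actAlong A Coalgebra.comul with
    invFun := actAlong A (S.rTensor H ∘ₗ Coalgebra.comul)
    left_inv := hS.actAlong_rTensor_comul
    right_inv := hS.actAlong_comul : A ⊗[R] H ≃ₗ[R] A ⊗[R] H } ≪≫ₗ
    TwistedTensor.ofTensor (leftTwist R H A)

theorem IsTwistedAntipode.smashEquiv_tmul (hS : IsTwistedAntipode S) (a : A) (h : H) :
    hS.smashEquiv A (a ⊗ₜ h) =
      TwistedTensor.tmul (leftTwist R H A) 1 h * TwistedTensor.tmul (leftTwist R H A) a 1 := by
  rw [TwistedTensor.tmul_mul_tmul, ← Algebra.TensorProduct.one_def, mul_one,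
    one_mul]
  rfl

/-- `a # h = ∑ (1 # h₂)(S(h₁) a # 1)`. -/
theorem IsTwistedAntipode.tmul_eq_smashEquiv (hS : IsTwistedAntipode S) (a : A) (h : H) :
    TwistedTensor.tmul (leftTwist R H A) a h =
      hS.smashEquiv A (actFirst R H A (S.rTensor H (Coalgebra.comul h)) a) :=
  ((hS.smashEquiv A).apply_symm_apply (TwistedTensor.tmul (leftTwist R H A) a h)).symm

/-- With H placed on the left in A # H, right multiplication by A only touches the factor A. -/
theorem IsTwistedAntipode.smashEquiv_mul (hS : IsTwistedAntipode S) (z : A ⊗[R] H) (b : A) :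
    hS.smashEquiv A z * TwistedTensor.tmul (leftTwist R H A) b 1 =
      hS.smashEquiv A (z * (b ⊗ₜ 1)) := by
  induction z with
  | zero => simp
  | add z w hz hw => simp only [map_add, add_mul, hz, hw]
  | tmul a h =>
    rw [Algebra.TensorProduct.tmul_mul_tmul, mul_one, hS.smashEquiv_tmul, hS.smashEquiv_tmul,
      mul_assoc, TwistedTensor.tmul_one_mul_tmul]

theorem coact_tmul (a : A) (h : H) :
    RightComoduleAlgebra.coact (R := R) (H := H) (TwistedTensor.tmul (leftTwist R H A) a h) =
      (TwistedTensor.ofTensor (leftTwist R H A)).toLinearMap.rTensor H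
        ((TensorProduct.assoc R A H H).symm (a ⊗ₜ Coalgebra.comul h)) := rfl

theorem coactHit_tmul (f : ConvDual R H) (a : A) (h : H) :
    coactHit R H (LeftSmash R H A) f (TwistedTensor.tmul (leftTwist R H A) a h) =
      TwistedTensor.tmul (leftTwist R H A) a (leftHit R H f h) := by
  rw [coactHit_apply, coact_tmul]
  change _ = TwistedTensor.ofTensor (leftTwist R H A)
    (a ⊗ₜ TensorProduct.rid R H (f.ofConv.lTensor H (Coalgebra.comul h)))
  generalize (Coalgebra.comul h : H ⊗[R] H) = s
  induction s with
  | zero => simp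
  | add s t hs ht => simp only [map_add, TensorProduct.tmul_add, hs, ht]
  | tmul p q => simp

/-- The element b # 1 is coinvariant, so right multiplication by it commutes with the action of H*.
-/
theorem coactHit_mul_tmul_one (f : ConvDual R H) (x : LeftSmash R H A) (b : A) :
    coactHit R H (LeftSmash R H A) f (x * TwistedTensor.tmul (leftTwist R H A) b 1) =
      coactHit R H (LeftSmash R H A) f x * TwistedTensor.tmul (leftTwist R H A) b 1 := by
  have h1 : RightComoduleAlgebra.coact (R := R) (H := H)
      (TwistedTensor.tmul (leftTwist R H A) b 1) =
      TwistedTensor.tmul (leftTwist R H A) b 1 ⊗ₜ[R] (1 : H) := by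
    rw [coact_tmul, Bialgebra.comul_one]
    rfl
  rw [coactHit_apply, coactHit_apply, map_mul, h1]
  generalize RightComoduleAlgebra.coact (R := R) (H := H) x = s
  induction s with
  | zero => simp
  | add s t hs ht => simp only [map_add, add_mul, hs, ht]
  | tmul p q => simp

end Decomposition

/-! ### The duality theorem -/

section Duality

variable {R : Type*} [CommRing R] {H : Type*} [Ring H] [Bialgebra R H] {S : H →ₗ[R] H}
  (A : Type*) [Ring A] [Algebra R A] [Module H A] [IsScalarTower R H A] [IsModuleAlgebra R H A]

/-- The action of `A ⊗ End(H)` on `A # H`, seen as `A ⊗ H` through `smashEquiv`. -/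
def IsTwistedAntipode.endRep (hS : IsTwistedAntipode S) :
    A ⊗[R] Module.End R H →ₐ[R] Module.End R (LeftSmash R H A) :=
  ((hS.smashEquiv A).conjAlgEquiv R).toAlgHom.comp <|
    (Module.endTensorEndAlgHom (R := R) (A := R) (M := A) (N := H)).comp <|
      Algebra.TensorProduct.map (Algebra.lmul R A) (AlgHom.id R _)

variable {A}

theorem IsTwistedAntipode.endRep_tmul_smashEquiv (hS : IsTwistedAntipode S) (a b : A)
    (T : Module.End R H) (k : H) :
    hS.endRep A (a ⊗ₜ T) (hS.smashEquiv A (b ⊗ₜ k)) = hS.smashEquiv A ((a * b) ⊗ₜ T k) := by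
  simp [IsTwistedAntipode.endRep, LinearEquiv.conjAlgEquiv_apply]
  rfl

theorem IsTwistedAntipode.end_ext (hS : IsTwistedAntipode S)
    {F G : Module.End R (LeftSmash R H A)}
    (h : ∀ b k, F (hS.smashEquiv A (b ⊗ₜ k)) = G (hS.smashEquiv A (b ⊗ₜ k))) : F = G := by
  have : F ∘ₗ (hS.smashEquiv A).toLinearMap = G ∘ₗ (hS.smashEquiv A).toLinearMap :=
    TensorProduct.ext' h
  ext x
  obtain ⟨x, rfl⟩ := (hS.smashEquiv A).surjective x
  exact LinearMap.congr_fun this x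

/-- These operators are common to both images. On (1 # k)(b # 1) the factor b # 1 can be split off
on the right, and on 1 # k both sides act as λ does on k. -/
theorem IsTwistedAntipode.endRep_leftRep (hS : IsTwistedAntipode S)
    (U : Subalgebra R (ConvDual R H)) (w : H ⊗[R] U) :
    hS.endRep A (1 ⊗ₜ leftRep U w) = smashRepMap U
      ((TwistedTensor.includeRight (leftTwist R H A)).toLinearMap.rTensor U w) := by
  induction w with
  | zero => simp
  | add w w' hw hw' => simp only [map_add, TensorProduct.tmul_add, hw, hw']
  | tmul h f =>
    refine hS.end_ext fun b k => ?_
    rw [hS.endRep_tmul_smashEquiv, LinearMap.rTensor_tmul, smashRepMap_tmul, one_mul,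
      hS.smashEquiv_tmul, hS.smashEquiv_tmul, coactHit_mul_tmul_one, coactHit_tmul, ← mul_assoc]
    congr 1
    exact (TwistedTensor.tmul_mul_one_tmul (leftTwist R H A) 1 h _).symm

/-- `a # 1` acts on `A # H` as `∑ a₀ ⊗ ρ(S* a₁)`. -/
theorem IsTwistedAntipode.mulLeft_eq_endRep (hS : IsTwistedAntipode S)
    (U : Subalgebra R (ConvDual R H)) (l : List (A × U)) (a : A)
    (hl : ∀ h : H, h • a = (l.map fun p => (p.2 : ConvDual R H) h • p.1).sum) :
    LinearMap.mulLeft R (TwistedTensor.tmul (leftTwist R H A) a 1) =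
      hS.endRep A (l.map fun p => p.1 ⊗ₜ[R] rightHit R H (dualMap S p.2)).sum := by
  refine hS.end_ext fun b k => ?_
  have h1 : ∀ l : List (A × U),
      hS.endRep A (l.map fun p => p.1 ⊗ₜ[R] rightHit R H (dualMap S p.2)).sum
        (hS.smashEquiv A (b ⊗ₜ k)) = hS.smashEquiv A
          ((l.map fun p => p.1 ⊗ₜ[R] rightHit R H (dualMap S p.2) k).sum * (b ⊗ₜ 1)) := by
    intro l
    induction l with
    | nil => simp
    | cons p l ih =>
      rw [List.map_cons, List.sum_cons, map_add, LinearMap.add_apply, ih,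
        hS.endRep_tmul_smashEquiv, List.map_cons, List.sum_cons, add_mul, map_add,
        Algebra.TensorProduct.tmul_mul_tmul, mul_one]
  -- Here (a # 1)(1 # k)(b # 1) = (a # k)(b # 1), and a # k is rewritten as ∑ (1 # k₂)(S(k₁) a # 1);
  -- this is where S* enters.
  rw [h1, LinearMap.mulLeft_apply, hS.smashEquiv_tmul, ← mul_assoc,
    TwistedTensor.tmul_one_mul_tmul, mul_one, hS.tmul_eq_smashEquiv, hS.smashEquiv_mul,
    actFirst_eq_sum U l a hl]
  rfl

/-- `a ⊗ 1` acts on `A # H` as `∑ (a₀ # 1) ρ(a₁)`. -/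
theorem IsTwistedAntipode.endRep_eq_sum (hS : IsTwistedAntipode S)
    (U : Subalgebra R (ConvDual R H)) (l : List (A × U)) (a : A)
    (hl : ∀ h : H, h • a = (l.map fun p => (p.2 : ConvDual R H) h • p.1).sum) :
    hS.endRep A (a ⊗ₜ 1) = (l.map fun p =>
      LinearMap.mulLeft R (TwistedTensor.tmul (leftTwist R H A) p.1 1) *
        hS.endRep A (1 ⊗ₜ rightHit R H p.2)).sum := by
  refine hS.end_ext fun b k => ?_
  have h1 : ∀ l : List (A × U), (l.map fun p =>
      LinearMap.mulLeft R (TwistedTensor.tmul (leftTwist R H A) p.1 1) *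
        hS.endRep A (1 ⊗ₜ rightHit R H p.2)).sum (hS.smashEquiv A (b ⊗ₜ k)) =
      TwistedTensor.ofTensor (leftTwist R H A)
        (l.map fun p => p.1 ⊗ₜ[R] rightHit R H p.2 k).sum *
        TwistedTensor.tmul (leftTwist R H A) b 1 := by
    intro l
    induction l with
    | nil => simp
    | cons p l ih =>
      rw [List.map_cons, List.sum_cons, LinearMap.add_apply, ih, Module.End.mul_apply,
        hS.endRep_tmul_smashEquiv, one_mul, hS.smashEquiv_tmul, LinearMap.mulLeft_apply,
        ← mul_assoc, TwistedTensor.tmul_one_mul_tmul, mul_one, List.map_cons, List.sum_cons,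
        map_add, add_mul, TwistedTensor.ofTensor_tmul]
  -- The case T = id reads (1 # k)(a # 1) = ∑ k₁ a # k₂ = ∑ a₀ # (k ↼ a₁). Multiplying by b # 1 on
  -- the right gives the claim.
  have h2 := actFirst_eq_sum U l a hl LinearMap.id (Coalgebra.comul k)
  rw [LinearMap.rTensor_id, LinearMap.id_apply] at h2
  have h3 : TwistedTensor.ofTensor (leftTwist R H A) (actFirst R H A (Coalgebra.comul k) a) =
      hS.smashEquiv A (a ⊗ₜ k) := rfl
  rw [h1, hS.endRep_tmul_smashEquiv]
  refine Eq.trans ?_ (congrArg (fun z => TwistedTensor.ofTensor (leftTwist R H A) z *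
    TwistedTensor.tmul (leftTwist R H A) b 1) h2)
  rw [h3, hS.smashEquiv_mul]
  simp

end Duality

/-! ### Faithfulness of the two actions and equality of their images. -/

section Isomorphism

variable {R : Type*} [CommRing R] {H : Type*} [Ring H] [Bialgebra R H] {S : H →ₗ[R] H}
  {A : Type*} [Ring A] [Algebra R A] [Module H A] [IsScalarTower R H A] [IsModuleAlgebra R H A]

/-- Already the restriction of the operators to 1 # H determines the element: on 1 # k, b # f takes
the value b (1 # (f ⇀ k)). -/
theorem IsTwistedAntipode.smashRep_injective (hS : IsTwistedAntipode S)
    (U : RightModuleSubalgebra R H)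
    (hU : Function.Injective (alphaMap U.toSubalgebra (LeftSmash R H A))) :
    Function.Injective (smashRep U (B := LeftSmash R H A)) := by
  have h := hS.injective_of_apply U.toSubalgebra hU
    (TwistedTensor.includeRight (leftTwist R H A)) (smashRepMap U.toSubalgebra)
    (LinearMap.lcomp R _ (TwistedTensor.includeRight (leftTwist R H A)).toLinearMap)
    (fun b f k => congrArg (b * ·) (coactHit_tmul (f : ConvDual R H) 1 k))
  exact h.comp (TwistedTensor.ofTensor _).symm.injective

/-- The action of `A ⊗ (H # U)` on `A # H`. -/
def IsTwistedAntipode.tensorRep (hS : IsTwistedAntipode S) (A : Type*) [Ring A] [Algebra R A]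
    [Module H A] [IsScalarTower R H A] [IsModuleAlgebra R H A] (U : RightModuleSubalgebra R H) :
    A ⊗[R] RightSmash U H →ₐ[R] Module.End R (LeftSmash R H A) :=
  (hS.endRep A).comp (Algebra.TensorProduct.map (AlgHom.id R A) (smashRep U))

theorem IsTwistedAntipode.tensorRep_tmul (hS : IsTwistedAntipode S) (U : RightModuleSubalgebra R H)
    (a : A) (w : H ⊗[R] U.toSubalgebra) :
    hS.tensorRep A U (a ⊗ₜ TwistedTensor.ofTensor (rightTwist U H) w) =
      hS.endRep A (a ⊗ₜ leftRep U.toSubalgebra w) := rfl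

/-- After regrouping as (A ⊗ H) ⊗ U and reading A # H as A ⊗ H, the values at 1 ⊗ k suffice: (a ⊗ h)
⊗ f yields (a ⊗ h)(1 ⊗ (f ⇀ k)). -/
theorem IsTwistedAntipode.tensorRep_injective (hS : IsTwistedAntipode S)
    (U : RightModuleSubalgebra R H)
    (hU : Function.Injective (alphaMap U.toSubalgebra (A ⊗[R] H))) :
    Function.Injective (hS.tensorRep A U) := by
  let e : (A ⊗[R] H) ⊗[R] U.toSubalgebra ≃ₗ[R] A ⊗[R] RightSmash U H :=
    TensorProduct.assoc R A H U.toSubalgebra ≪≫ₗ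
      (TwistedTensor.ofTensor (rightTwist U H)).lTensor A
  have h := hS.injective_of_apply U.toSubalgebra hU
    (Algebra.TensorProduct.includeRight : H →ₐ[R] A ⊗[R] H)
    ((hS.tensorRep A U).toLinearMap ∘ₗ e.toLinearMap)
    (LinearMap.llcomp R H (LeftSmash R H A) (A ⊗[R] H) (hS.smashEquiv A).symm.toLinearMap ∘ₗ
      LinearMap.lcomp R _ ((hS.smashEquiv A).toLinearMap ∘ₗ TensorProduct.mk R A H 1))
    (by
      intro b f k
      induction b with
      | zero => simp only [TensorProduct.zero_tmul, map_zero, LinearMap.zero_apply, zero_mul]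
      | add b c hb hc =>
        simp only [TensorProduct.add_tmul, map_add, LinearMap.add_apply, add_mul, hb, hc]
      | tmul a h =>
        change (hS.smashEquiv A).symm (hS.endRep A (a ⊗ₜ leftRep U.toSubalgebra (h ⊗ₜ f))
          (hS.smashEquiv A (1 ⊗ₜ k))) = _
        rw [hS.endRep_tmul_smashEquiv, LinearEquiv.symm_apply_apply]
        simp)
  have h' := h.comp e.symm.injective
  have : ⇑((hS.tensorRep A U).toLinearMap ∘ₗ e.toLinearMap) ∘ ⇑e.symm = hS.tensorRep A U := by
    ext z : 1
    simp
  rwa [this] at h'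

/-- The first image is spanned by the products (a # 1) · (1 ⊗ λ(w)), the second by the products (a ⊗
1)(1 ⊗ λ(w)). It remains to place a # 1 in the second image, by `h₂`, and a ⊗ 1 in the first, by
`h₁`. -/
theorem IsTwistedAntipode.range_smashRep (hS : IsTwistedAntipode S) (U : RightModuleSubalgebra R H)
    (r : A → List (A × U.toSubalgebra))
    (hr : ∀ (h : H) (a : A), h • a = ((r a).map fun p => (p.2 : ConvDual R H) h • p.1).sum)
    (h₁ : ∀ a, ∀ p ∈ r a, rightHit R H p.2 ∈ LinearMap.range (leftRep U.toSubalgebra))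
    (h₂ : ∀ a, ∀ p ∈ r a,
      rightHit R H (dualMap S p.2) ∈ LinearMap.range (leftRep U.toSubalgebra)) :
    (smashRep U (B := LeftSmash R H A)).range = (hS.tensorRep A U).range := by
  have hmem : ∀ a, ∀ T ∈ LinearMap.range (leftRep U.toSubalgebra),
      hS.endRep A (a ⊗ₜ T) ∈ (hS.tensorRep A U).range := by
    rintro a _ ⟨w, rfl⟩
    exact ⟨_, hS.tensorRep_tmul U a w⟩
  have hmem' : ∀ T ∈ LinearMap.range (leftRep U.toSubalgebra),
      hS.endRep A (1 ⊗ₜ T) ∈ (smashRep U (B := LeftSmash R H A)).range := by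
    rintro _ ⟨w, rfl⟩
    rw [hS.endRep_leftRep]
    exact ⟨_, smashRep_ofTensor U _⟩
  have hL : ∀ a : A, LinearMap.mulLeft R (TwistedTensor.tmul (leftTwist R H A) a 1) ∈
      (hS.tensorRep A U).range := by
    intro a
    rw [hS.mulLeft_eq_endRep U.toSubalgebra (r a) a fun h => hr h a, map_list_sum]
    refine list_sum_mem fun x hx => ?_
    simp only [List.map_map, List.mem_map, Function.comp_apply] at hx
    obtain ⟨p, hp, rfl⟩ := hx
    exact hmem _ _ (h₂ a p hp)
  have hL' : ∀ b : LeftSmash R H A, LinearMap.mulLeft R b ∈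
      (smashRep U (B := LeftSmash R H A)).range := by
    -- The unit of U is ε, and ε ⇀ c = c by counitality, so b # ε acts as left multiplication by b.
    refine fun b => ⟨TwistedTensor.tmul _ b 1, ?_⟩
    have h1 : coactHit R H (LeftSmash R H A) 1 = 1 := by
      ext c
      exact RightComoduleAlgebra.counit c
    ext c
    change b * coactHit R H (LeftSmash R H A) 1 c = b * c
    rw [h1, Module.End.one_apply]
  apply le_antisymm
  · rintro _ ⟨x, rfl⟩
    obtain ⟨x, rfl⟩ := (TwistedTensor.ofTensor _).surjective x
    change smashRepMap U.toSubalgebra x ∈ _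
    induction x with
    | zero => simp
    | add x y hx hy => rw [map_add]; exact add_mem hx hy
    | tmul b f =>
      obtain ⟨b, rfl⟩ := (TwistedTensor.ofTensor _).surjective b
      induction b with
      | zero => simp
      | add b c hb hc =>
        rw [map_add, TensorProduct.add_tmul, map_add]
        exact add_mem hb hc
      | tmul a h =>
        have : smashRepMap U.toSubalgebra
            (TwistedTensor.ofTensor (leftTwist R H A) (a ⊗ₜ h) ⊗ₜ[R] f) =
            LinearMap.mulLeft R (TwistedTensor.tmul (leftTwist R H A) a 1) *
              hS.endRep A (1 ⊗ₜ leftRep U.toSubalgebra (h ⊗ₜ f)) := by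
          rw [hS.endRep_leftRep]
          ext c
          simp only [LinearMap.rTensor_tmul, smashRepMap_tmul, Module.End.mul_apply,
            LinearMap.mulLeft_apply, ← mul_assoc]
          congr 1
          refine Eq.trans ?_ (TwistedTensor.tmul_one_mul_tmul (leftTwist R H A) a 1 h).symm
          rw [mul_one]
          rfl
        rw [this]
        exact mul_mem (hL a) (hmem _ _ ⟨_, rfl⟩)
  · rintro _ ⟨x, rfl⟩
    change hS.tensorRep A U x ∈ _
    induction x with
    | zero => simp
    | add x y hx hy => rw [map_add]; exact add_mem hx hy
    | tmul a w =>
      obtain ⟨w, rfl⟩ := (TwistedTensor.ofTensor _).surjective w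
      have : a ⊗ₜ[R] leftRep U.toSubalgebra w = (a ⊗ₜ 1) * (1 ⊗ₜ leftRep U.toSubalgebra w) := by
        simp
      rw [hS.tensorRep_tmul, this, map_mul]
      refine mul_mem ?_ (hmem' _ ⟨w, rfl⟩)
      rw [hS.endRep_eq_sum U.toSubalgebra (r a) a fun h => hr h a]
      refine list_sum_mem fun x hx => ?_
      simp only [List.mem_map] at hx
      obtain ⟨p, hp, rfl⟩ := hx
      exact mul_mem (hL' _) (hmem' _ (h₁ a p hp))

end Isomorphism

end
end HopfDuality

theorem mainTheorem2
    {R : Type*} [CommRing R] [IsNoetherianRing R]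
    {H : Type*} [Ring H] [HopfAlgebra R H] (hH : HopfDuality.IsAlphaAlgebra R H)
    (S' : H →ₗ[R] H) (hS' : HopfDuality.IsTwistedAntipode S')
    (U : HopfDuality.SubBialgebra R H)
    {A : Type*} [Ring A] [Algebra R A] [Module H A] [IsScalarTower R H A]
    [HopfDuality.IsModuleAlgebra R H A]
    (hA : HopfDuality.IsLocallyFinite U.toSubalgebra A)
    (r : A → List (A × U.toSubalgebra)) (hr : HopfDuality.IsExpansion U.toSubalgebra r)
    (V : Submodule R (HopfDuality.ConvDual R H))
    (hV : ∀ f ∈ V, ∀ h : H, HopfDuality.rightReg R H f h ∈ V)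
    (hCf : HopfDuality.Cf U.toSubalgebra r ≤ V)
    (hSCf : (HopfDuality.Cf U.toSubalgebra r).map (HopfDuality.dualMap S') ≤ V)
    (hRL : HopfDuality.RLCondition V U.toSubalgebra) :
    Nonempty
      (HopfDuality.RightSmash U.toRightModuleSubalgebra (HopfDuality.LeftSmash R H A) ≃ₐ[R]
        A ⊗[R] HopfDuality.RightSmash U.toRightModuleSubalgebra H) := by
  have hr' := fun h a => HopfDuality.smul_eq_sum_expansion hH U hA hr h a
  have hmem : ∀ a, ∀ p ∈ r a, (p.2 : HopfDuality.ConvDual R H) ∈ HopfDuality.Cf U.toSubalgebra r :=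
    fun a p hp => Submodule.subset_span ⟨a, p, hp, rfl⟩
  -- The RL-condition enters twice: for the coefficients a₁ and for their images under the dual of
  -- the twisted antipode.
  have hrange := hS'.range_smashRep U.toRightModuleSubalgebra r hr'
    (fun a p hp => hRL ⟨_, hCf (hmem a p hp), rfl⟩)
    (fun a p hp => hRL ⟨_, hSCf ⟨_, hmem a p hp, rfl⟩, rfl⟩)
  exact ⟨(AlgEquiv.ofInjective _ (hS'.smashRep_injective U.toRightModuleSubalgebra
    (U.alphaMap_injective hH _))).trans <| (Subalgebra.equivOfEq _ _ hrange).trans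
    (AlgEquiv.ofInjective _ (hS'.tensorRep_injective U.toRightModuleSubalgebra
      (U.alphaMap_injective hH _))).symm⟩
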